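/- Let $A=(a_{ij})_{i,j\in I}$, $I=\{1,\dots,n\}$, be a symmetrizable generalized Cartan matrix of rank $r$. Let $H$ and $P=\mathrm{Hom}(H,\mathbb Z)$ be dual free $\mathbb Z$-modules of rank $2n-r$ with linearly independent families $h_1,\dots,h_n\in H$ and $\alpha_1,\dots,\alpha_n\in P$ such that $\alpha_i(h_j)=a_{ji}$, and such that there are $\Lambda_1,\dots,\Lambda_n\in P$ with $\Lambda_i(h_j)=\delta_{ij}$. Let $\mathcal W$ be the Weyl group, i.e. the Coxeter group with generators $\sigma_i$ ($i\in I$) and relations $\sigma_i^2=1$ and $(\sigma_i\sigma_j)^{m_{ij}}=1$ ($i\neq j$), where $m_{ij}=2,3,4,6$ if $a_{ij}a_{ji}=0,1,2,3$ respectively and there is no relation between $\sigma_i$ and $\sigma_j$ if $a_{ij}a_{ji}\ge 4$; let $l$ denote its length function. It acts on $H$ by $\sigma_i h=h-\alpha_i(h)h_i$ and on $P$ and $\mathbf h_{\mathbb R}^*=P\otimes\mathbb R$ by $\sigma_i\lambda=\lambda-\lambda(h_i)\alpha_i$. Put $\Delta_{re}=\mathcal W\{\alpha_i\mid i\in I\}$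 and let $\Delta_{re}^{\pm}$ be the set of those $\beta\in\Delta_{re}$ for which $\pm\beta$ is a nonzero non-negative integral combination of the $\alpha_i$. For $J\subseteq I$ let $\mathcal W_J$ be generated by the $\sigma_j$, $j\in J$, let $\mathcal W^J$ (resp. ${}^J\mathcal W$) be the set of minimal length representatives of the cosets in $\mathcal W/\mathcal W_J$ (resp. $\mathcal W_J\backslash\mathcal W$), and put $\mathcal W_JJ=\mathcal W_J\{\alpha_j\mid j\in J\}$. Let $X=\mathcal W\{\lambda\in\mathbf h^*_{\mathbb R}\mid \lambda(h_i)\ge 0\ \forall i\in I\}$ be the Tits cone. The Weyl monoid $\widehat{\mathcal W}$ is the quotient of the monoid of pairs $(R,\sigma)$, with $R$ a (nonempty) face of $X$ and $\sigma\in\mathcal W$, with product $(R,\sigma)(S,\tau)=(R\cap\sigma S,\sigma\tau)$, by the congruence relation: $(R,\sigma)\sim(R',\sigma')$ iff $R=R'$ and $\sigma'\sigma^{-1}$ fixes $R$ pointwise. Write $e(R)$ for the class of $(R,1)$ and identify $\sigma\in\mathcal W$ with the class of $(X,\sigma)$. A set $\Theta\subseteq I$ is special if every connected component of $(a_{ij})_{i,j\in\Theta}$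 is of non-finite type (in particular $\emptyset$ is special). For such $\Theta$ let $\Theta^\bot=\{i\in I\mid a_{ij}=0\ \forall j\in\Theta\}$ and let $R(\Theta)=X\cap\{\lambda\mid\lambda(h_i)=0\ \forall i\in\Theta\}$, which is a face of $X$. Every $\hat w\in\widehat{\mathcal W}$ can be written uniquely as $\hat w=w_1e(R(\Theta))w_2$ with $\Theta$ special, $w_1\in\mathcal W^{\Theta}$, $w_2\in{}^{\Theta\cup\Theta^\bot}\mathcal W$ (normal form I), and uniquely with $\Theta$ special, $w_1\in\mathcal W^{\Theta\cup\Theta^\bot}$, $w_2\in{}^{\Theta}\mathcal W$ (normal form II). Define $l_{++}(\hat w)=l(w_1)-l(w_2)\in\mathbb Z$ using normal form I, $l_{--}(\hat w)=-l(w_1)+l(w_2)\in\mathbb Z$ using normal form II, and $l_{-+}(\hat w)=l(w_1)+l(w_2)\in\mathbb N_0$ using normal form I or II (both give the same value). **Theorem 3.3.** Let $i\in I$. **1)** Let $\hat w=w_1e(R(\Theta))w_2$ be in normal form I and put $\beta=w_1^{-1}\alpha_i$. Then $$l_{++}(\sigma_i\hat w)=\begin{cases}l_{++}(\hat w)+1&\text{for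 }\beta\in\Delta_{re}^+\setminus\mathcal W_\Theta\Theta\\ l_{++}(\hat w)&\text{for }\beta\in\mathcal W_\Theta\Theta\\ l_{++}(\hat w)-1&\text{for }\beta\in\Delta_{re}^-\setminus\mathcal W_\Theta\Theta,\end{cases}$$ $$l_{--}(\sigma_i\hat w)=\begin{cases}l_{--}(\hat w)+1&\text{for }\beta\in\bigl(\Delta_{re}^-\setminus\mathcal W_{\Theta\cup\Theta^\bot}(\Theta\cup\Theta^\bot)\bigr)\cup\bigl(\Delta_{re}^+\cap\mathcal W_{\Theta^\bot}\Theta^\bot\bigr)\\ l_{--}(\hat w)&\text{for }\beta\in\mathcal W_\Theta\Theta\\ l_{--}(\hat w)-1&\text{for }\beta\in\bigl(\Delta_{re}^+\setminus\mathcal W_{\Theta\cup\Theta^\bot}(\Theta\cup\Theta^\bot)\bigr)\cup\bigl(\Delta_{re}^-\cap\mathcal W_{\Theta^\bot}\Theta^\bot\bigr),\end{cases}$$ $$l_{-+}(\sigma_i\hat w)=\begin{cases}l_{-+}(\hat w)+1&\text{for }\beta\in\Delta_{re}^+\setminus\mathcal W_\Theta\Theta\\ l_{-+}(\hat w)&\text{for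 }\beta\in\mathcal W_\Theta\Theta\\ l_{-+}(\hat w)-1&\text{for }\beta\in\Delta_{re}^-\setminus\mathcal W_\Theta\Theta,\end{cases}$$ where in each of the three formulas one of the listed cases occurs. For each of the three functions $l_{++},l_{--},l_{-+}$ the values at $\sigma_i\hat w$ and $\hat w$ are equal if and only if $\sigma_i\hat w=\hat w$. **2)** Let $\hat w=w_1e(R(\Theta))w_2$ be in normal form II and put $\gamma=w_2\alpha_i$. Then $$l_{++}(\hat w\sigma_i)=\begin{cases}l_{++}(\hat w)+1&\text{for }\gamma\in\bigl(\Delta_{re}^-\setminus\mathcal W_{\Theta\cup\Theta^\bot}(\Theta\cup\Theta^\bot)\bigr)\cup\bigl(\Delta_{re}^+\cap\mathcal W_{\Theta^\bot}\Theta^\bot\bigr)\\ l_{++}(\hat w)&\text{for }\gamma\in\mathcal W_\Theta\Theta\\ l_{++}(\hat w)-1&\text{for }\gamma\in\bigl(\Delta_{re}^+\setminus\mathcal W_{\Theta\cup\Theta^\bot}(\Theta\cup\Theta^\bot)\bigr)\cup\bigl(\Delta_{re}^-\cap\mathcal W_{\Theta^\bot}\Theta^\bot\bigr),\end{cases}$$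 $$l_{--}(\hat w\sigma_i)=\begin{cases}l_{--}(\hat w)+1&\text{for }\gamma\in\Delta_{re}^+\setminus\mathcal W_\Theta\Theta\\ l_{--}(\hat w)&\text{for }\gamma\in\mathcal W_\Theta\Theta\\ l_{--}(\hat w)-1&\text{for }\gamma\in\Delta_{re}^-\setminus\mathcal W_\Theta\Theta,\end{cases}$$ $$l_{-+}(\hat w\sigma_i)=\begin{cases}l_{-+}(\hat w)+1&\text{for }\gamma\in\Delta_{re}^+\setminus\mathcal W_\Theta\Theta\\ l_{-+}(\hat w)&\text{for }\gamma\in\mathcal W_\Theta\Theta\\ l_{-+}(\hat w)-1&\text{for }\gamma\in\Delta_{re}^-\setminus\mathcal W_\Theta\Theta,\end{cases}$$ where in each of the three formulas one of the listed cases occurs. For each of the three functions $l_{++},l_{--},l_{-+}$ the values at $\hat w\sigma_i$ and $\hat w$ are equal if and only if $\hat w\sigma_i=\hat w$. -/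

import Mathlib

open Set

/-! ### Generalized Cartan matrices -/

/-- A symmetrizable generalized Cartan matrix with finite index set `ι`. -/
structure SymmGCM (ι : Type*) [Fintype ι] [DecidableEq ι] where
  a : Matrix ι ι ℤ
  diag : ∀ i, a i i = 2
  off_diag : ∀ i j, i ≠ j → a i j ≤ 0
  zero_iff : ∀ i j, a i j = 0 ↔ a j i = 0
  /-- `A = D B` with `D` a positive rational diagonal matrix, `B` a symmetric rational matrix. -/
  symmetrizable : ∃ (ε : ι → ℚ) (B : Matrix ι ι ℚ), (∀ i, 0 < ε i) ∧ B.IsSymm ∧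
    a.map (fun z : ℤ => (z : ℚ)) = Matrix.diagonal ε * B

/-- Finite type, for an (indecomposable) generalized Cartan matrix `M`: `det M ≠ 0`; there is
`u > 0` with `M u > 0`; and `M v ≥ 0` implies `v > 0` or `v = 0` (inequalities of real vectors
are understood in all coordinates). -/
def IsFiniteType {κ : Type*} [Fintype κ] [DecidableEq κ] (M : Matrix κ κ ℤ) : Prop :=
  M.det ≠ 0 ∧
  (∃ u : κ → ℝ, (∀ k, 0 < u k) ∧ ∀ k, 0 < ∑ m, (M k m : ℝ) * u m) ∧
  ∀ v : κ → ℝ, (∀ k, 0 ≤ ∑ m, (M k m : ℝ) * v m) → (∀ k, 0 < v k) ∨ v = 0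

namespace SymmGCM

variable {ι : Type*} [Fintype ι] [DecidableEq ι] (A : SymmGCM ι)

/-- The graph on the index set in which distinct `i`, `j` are joined iff `a i j ≠ 0`. -/
def graph : SimpleGraph ι where
  Adj i j := i ≠ j ∧ A.a i j ≠ 0
  symm := ⟨fun _ _ h => ⟨h.1.symm, fun h0 => h.2 ((A.zero_iff _ _).2 h0)⟩⟩
  loopless := ⟨fun _ h => h.1 rfl⟩

open Classical in
/-- `Θ` is special: every connected component of the submatrix indexed by `Θ` is of non-finite
type (in particular `∅` is special). -/
def IsSpecial (Θ : Set ι) : Prop :=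
  ∀ c : (A.graph.induce Θ).ConnectedComponent,
    ¬ IsFiniteType (A.a.submatrix (fun k : c.supp => ((k : Θ) : ι)) (fun k : c.supp => ((k : Θ) : ι)))

/-- `Θ^⊥`. -/
def perp (Θ : Set ι) : Set ι := {i | ∀ j ∈ Θ, A.a i j = 0}

/-- The Coxeter exponents: `2, 3, 4, 6` for `a i j * a j i = 0, 1, 2, 3`; the value `0` stands for
"no relation". -/
def coxeterMatrix : CoxeterMatrix ι where
  M := Matrix.of fun i j =>
    if i = j then 1
    else if A.a i j * A.a j i = 0 then 2
    else if A.a i j * A.a j i = 1 then 3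
    else if A.a i j * A.a j i = 2 then 4
    else if A.a i j * A.a j i = 3 then 6
    else 0
  isSymm := by
    ext i j
    simp only [Matrix.transpose_apply, Matrix.of_apply, mul_comm (A.a i j), eq_comm (a := i)]
  diagonal i := by simp
  off_diagonal i j h := by
    simp only [Matrix.of_apply, if_neg h]
    split_ifs <;> decide

/-- The Weyl group: the Coxeter group with generators `σ i`. -/
abbrev Weyl : Type _ := A.coxeterMatrix.Group

/-- The Weyl group as a Coxeter system. -/
abbrev cs : CoxeterSystem A.coxeterMatrix A.Weyl := A.coxeterMatrix.toCoxeterSystem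

/-- The simple reflections. -/
abbrev σ (i : ι) : A.Weyl := A.cs.simple i

/-- The standard parabolic subgroup `W_J`. -/
def parabolic (J : Set ι) : Subgroup A.Weyl := Subgroup.closure (A.σ '' J)

/-- `W^J`, the minimal coset representatives of `W / W_J`. -/
def minRight (J : Set ι) : Set A.Weyl :=
  {w | ∀ v ∈ A.parabolic J, A.cs.length w ≤ A.cs.length (w * v)}

/-- `^J W`, the minimal coset representatives of `W_J \ W`. -/
def minLeft (J : Set ι) : Set A.Weyl :=
  {w | ∀ v ∈ A.parabolic J, A.cs.length w ≤ A.cs.length (v * w)}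

end SymmGCM

/-! ### Realizations -/

/-- A simply connected minimal free realization of `A`: the lattice `H` is a free `ℤ`-module of
rank `2 n - r`, `r` the rank of `A`, and `P` is its dual `Module.Dual ℤ H`. -/
structure Realization {ι : Type*} [Fintype ι] [DecidableEq ι] (A : SymmGCM ι)
    (H : Type*) [AddCommGroup H] [Module.Free ℤ H] [Module.Finite ℤ H] where
  /-- the simple coroots `h_i` -/
  h : ι → H
  /-- the simple roots `α_i` -/
  α : ι → Module.Dual ℤ H
  rank_eq : Module.finrank ℤ H + (A.a.map (fun z : ℤ => (z : ℚ))).rank = 2 * Fintype.card ι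
  indep_h : LinearIndependent ℤ h
  indep_α : LinearIndependent ℤ α
  pairing : ∀ i j, α i (h j) = A.a j i
  /-- fundamental dominant weights exist -/
  exists_fundamental : ∃ Λ : ι → Module.Dual ℤ H, ∀ i j, Λ i (h j) = if i = j then 1 else 0

namespace Realization

variable {ι : Type*} [Fintype ι] [DecidableEq ι] {A : SymmGCM ι}
  {H : Type*} [AddCommGroup H] [Module.Free ℤ H] [Module.Finite ℤ H] (D : Realization A H)

/-- The simple reflection `h ↦ h - α_i(h) h_i` of `H`. -/
def refl (i : ι) : Module.End ℤ H := LinearMap.id - (D.α i).smulRight (D.h i)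

theorem refl_apply (i : ι) (x : H) : D.refl i x = x - D.α i x • D.h i := rfl

theorem refl_mul_refl (i j : ι) (x : H) (u v : ℤ) :
    (D.refl i * D.refl j) (x + u • D.h i + v • D.h j) =
      x + (-u - D.α i x - (-v - D.α j x - u * A.a i j) * A.a j i) • D.h i
        + (-v - D.α j x - u * A.a i j) • D.h j := by
  simp only [Module.End.mul_apply, refl_apply, map_add, map_sub, map_smul, D.pairing, A.diag]
  module

theorem refl_liftable : A.coxeterMatrix.IsLiftable D.refl := by
  intro i j
  have key := D.refl_mul_refl i j
  have hM : A.coxeterMatrix i j = if i = j then 1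
    else if A.a i j * A.a j i = 0 then 2
    else if A.a i j * A.a j i = 1 then 3
    else if A.a i j * A.a j i = 2 then 4
    else if A.a i j * A.a j i = 3 then 6
    else 0 := rfl
  rw [hM]
  have fin : ∀ (x : H) (u v : ℤ), u = 0 → v = 0 → x + u • D.h i + v • D.h j = x := by
    rintro x u v rfl rfl
    simp
  have start : ∀ x : H, x = x + (0 : ℤ) • D.h i + (0 : ℤ) • D.h j := by
    intro x
    simp
  split_ifs with h1 h2 h3 h4 h5
  · subst h1
    ext x
    simp only [pow_one, Module.End.mul_apply, refl_apply, map_sub, map_smul, D.pairing, A.diag,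
      Module.End.one_apply]
    module
  · have hj : A.a j i = 0 := by
      rcases mul_eq_zero.1 h2 with h | h
      · exact (A.zero_iff _ _).1 h
      · exact h
    have hi : A.a i j = 0 := (A.zero_iff _ _).2 hj
    ext x
    rw [Module.End.one_apply]
    conv_lhs => rw [start x]
    simp only [pow_succ, pow_zero, one_mul, Module.End.mul_apply (_ * _) (D.refl i * D.refl j), key]
    apply fin <;> rw [hi, hj] <;> ring
  · ext x
    rw [Module.End.one_apply]
    conv_lhs => rw [start x]
    simp only [pow_succ, pow_zero, one_mul, Module.End.mul_apply (_ * _) (D.refl i * D.refl j), key]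
    apply fin <;> grind
  · ext x
    rw [Module.End.one_apply]
    conv_lhs => rw [start x]
    simp only [pow_succ, pow_zero, one_mul, Module.End.mul_apply (_ * _) (D.refl i * D.refl j), key]
    apply fin <;> grind
  · ext x
    rw [Module.End.one_apply]
    conv_lhs => rw [start x]
    simp only [pow_succ, pow_zero, one_mul, Module.End.mul_apply (_ * _) (D.refl i * D.refl j), key]
    apply fin <;> grind
  · simp

/-- The action of the Weyl group on `H`. -/
def rep : A.Weyl →* Module.End ℤ H := A.cs.lift ⟨D.refl, D.refl_liftable⟩

/-- The contragredient action `(w λ)(x) = λ(w⁻¹ x)` of the Weyl group on `Hom(H, R)`; for `R = ℤ`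
this is the action on `P`, for `R = ℝ` the action on the real dual `𝐡*_ℝ` of `H ⊗ ℝ`. -/
def act {R : Type*} [AddCommGroup R] (w : A.Weyl) (l : H →ₗ[ℤ] R) : H →ₗ[ℤ] R :=
  l ∘ₗ D.rep w⁻¹

theorem act_simple_apply (i : ι) {R : Type*} [AddCommGroup R] (l : H →ₗ[ℤ] R) (x : H) :
    D.act (A.σ i) l x = l x - D.α i x • l (D.h i) := by
  have h : D.rep (A.σ i)⁻¹ = D.refl i := by
    rw [CoxeterSystem.inv_simple]
    exact A.cs.lift_apply_simple D.refl_liftable i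
  rw [act, h, LinearMap.comp_apply, refl_apply, map_sub, map_smul]

theorem act_one {R : Type*} [AddCommGroup R] (l : H →ₗ[ℤ] R) : D.act 1 l = l := by
  ext x
  simp [act]

theorem act_mul {R : Type*} [AddCommGroup R] (v w : A.Weyl) (l : H →ₗ[ℤ] R) :
    D.act (v * w) l = D.act v (D.act w l) := by
  ext x
  simp [act]

theorem act_inv_act {R : Type*} [AddCommGroup R] (w : A.Weyl) (l : H →ₗ[ℤ] R) :
    D.act w⁻¹ (D.act w l) = l := by
  rw [← act_mul, inv_mul_cancel, act_one]

theorem act_act_inv {R : Type*} [AddCommGroup R] (w : A.Weyl) (l : H →ₗ[ℤ] R) :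
    D.act w (D.act w⁻¹ l) = l := by
  rw [← act_mul, mul_inv_cancel, act_one]

theorem act_comb (w : A.Weyl) (a b : ℝ) (x y : H →ₗ[ℤ] ℝ) :
    D.act w (a • x + b • y) = a • D.act w x + b • D.act w y := rfl

/-! ### Real roots -/

/-- `Δ_re = W {α_i}`. -/
def realRoots : Set (Module.Dual ℤ H) := {β | ∃ (w : A.Weyl) (i : ι), β = D.act w (D.α i)}

/-- `Q₀⁺`, the span of the simple roots with non-negative integral coefficients. -/
def Qpos : AddSubmonoid (Module.Dual ℤ H) := AddSubmonoid.closure (range D.α)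

/-- The positive real roots. -/
def posRoots : Set (Module.Dual ℤ H) := {β ∈ D.realRoots | β ∈ D.Qpos ∧ β ≠ 0}

/-- The negative real roots. -/
def negRoots : Set (Module.Dual ℤ H) := {β ∈ D.realRoots | -β ∈ D.Qpos ∧ β ≠ 0}

/-- `W_J J = W_J {α_j | j ∈ J}`. -/
def subRoots (J : Set ι) : Set (Module.Dual ℤ H) :=
  {β | ∃ w ∈ A.parabolic J, ∃ j ∈ J, β = D.act w (D.α j)}

/-! ### The Tits cone and its faces -/

/-- The closed fundamental chamber in `𝐡*_ℝ`. -/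
def chamber : Set (H →ₗ[ℤ] ℝ) := {l | ∀ i, 0 ≤ l (D.h i)}

/-- The Tits cone, the union of the Weyl group translates of the fundamental chamber. -/
def tits : Set (H →ₗ[ℤ] ℝ) := {l | ∃ (w : A.Weyl), ∃ m ∈ D.chamber, l = D.act w m}

/-- Faces of the Tits cone `X`: nonempty extreme convex subsets of `X`.  Convexity is written
relative to `X`, as `segment x y ∩ X ⊆ F` for `x, y ∈ F`; since `X` is convex, this is the same as
`segment x y ⊆ F`.  (A nonempty extreme convex subset of a convex cone is itself a convex cone.) -/
structure IsFace (F : Set (H →ₗ[ℤ] ℝ)) : Prop where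
  nonempty : F.Nonempty
  extreme : IsExtreme ℝ D.tits F
  convex : ∀ x ∈ F, ∀ y ∈ F, segment ℝ x y ∩ D.tits ⊆ F

theorem zero_mem_tits : (0 : H →ₗ[ℤ] ℝ) ∈ D.tits := by
  refine ⟨1, 0, fun i => ?_, ?_⟩
  · simp
  · rw [act_one]

theorem act_mem_tits (w : A.Weyl) {l : H →ₗ[ℤ] ℝ} (hl : l ∈ D.tits) : D.act w l ∈ D.tits := by
  obtain ⟨v, m, hm, rfl⟩ := hl
  exact ⟨w * v, m, hm, (D.act_mul w v m).symm⟩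

theorem smul_mem_tits (c : ℝ) (hc : 0 ≤ c) {l : H →ₗ[ℤ] ℝ} (hl : l ∈ D.tits) :
    c • l ∈ D.tits := by
  obtain ⟨v, m, hm, rfl⟩ := hl
  exact ⟨v, c • m, fun i => mul_nonneg hc (hm i), rfl⟩

variable {D} in
theorem IsFace.zero_mem {F : Set (H →ₗ[ℤ] ℝ)} (hF : D.IsFace F) : (0 : H →ₗ[ℤ] ℝ) ∈ F := by
  obtain ⟨x, hx⟩ := hF.nonempty
  have hxX := hF.extreme.subset hx
  refine hF.extreme.left_mem_of_mem_openSegment D.zero_mem_tits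
    (D.smul_mem_tits 2 (by norm_num) hxX) hx ?_
  refine ⟨1 / 2, 1 / 2, by norm_num, by norm_num, by norm_num, ?_⟩
  rw [smul_zero, zero_add, smul_smul]
  norm_num

theorem isFace_tits : D.IsFace D.tits where
  nonempty := ⟨0, D.zero_mem_tits⟩
  extreme := IsExtreme.refl ℝ _
  convex _ _ _ _ := inter_subset_right

variable {D} in
theorem IsFace.inter {F G : Set (H →ₗ[ℤ] ℝ)} (hF : D.IsFace F) (hG : D.IsFace G) :
    D.IsFace (F ∩ G) where
  nonempty := ⟨0, hF.zero_mem, hG.zero_mem⟩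
  extreme := hF.extreme.inter hG.extreme
  convex x hx y hy := subset_inter (hF.convex x hx.1 y hy.1) (hG.convex x hx.2 y hy.2)

variable {D} in
theorem IsFace.image {F : Set (H →ₗ[ℤ] ℝ)} (hF : D.IsFace F) (w : A.Weyl) :
    D.IsFace (D.act w '' F) where
  nonempty := hF.nonempty.image _
  extreme := by
    refine ⟨?_, ?_⟩
    · rintro _ ⟨x, hx, rfl⟩
      exact D.act_mem_tits w (hF.extreme.subset hx)
    · rintro x hx y hy _ ⟨z, hz, rfl⟩ ⟨a, b, ha, hb, hab, h⟩
      refine ⟨D.act w⁻¹ x, ?_, D.act_act_inv w x⟩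
      refine hF.extreme.left_mem_of_mem_openSegment (D.act_mem_tits _ hx)
        (D.act_mem_tits w⁻¹ hy) hz ⟨a, b, ha, hb, hab, ?_⟩
      rw [← act_comb, h, act_inv_act]
  convex := by
    rintro _ ⟨x, hx, rfl⟩ _ ⟨y, hy, rfl⟩ z ⟨⟨a, b, ha, hb, hab, h⟩, hz⟩
    refine ⟨D.act w⁻¹ z, ?_, D.act_act_inv w z⟩
    refine hF.convex x hx y hy ⟨⟨a, b, ha, hb, hab, ?_⟩, D.act_mem_tits _ hz⟩
    rw [← h, act_comb, act_inv_act, act_inv_act]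

/-- The set of faces of the Tits cone. -/
abbrev Face : Type _ := {F : Set (H →ₗ[ℤ] ℝ) // D.IsFace F}

/-- `R(Θ)` as a set: the points of the Tits cone on which all `h_i`, `i ∈ Θ`, vanish. -/
def RSet (Θ : Set ι) : Set (H →ₗ[ℤ] ℝ) := D.tits ∩ {l | ∀ i ∈ Θ, l (D.h i) = 0}

open Classical in
/-- `R(Θ)` as a face. For special `Θ` the set `RSet Θ` is a face, so that only the first branch
matters. -/
noncomputable def R (Θ : Set ι) : D.Face :=
  if hF : D.IsFace (D.RSet Θ) then ⟨D.RSet Θ, hF⟩ else ⟨D.tits, D.isFace_tits⟩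

/-! ### The Weyl monoid -/

/-- The underlying set of the semidirect product of the monoid of faces (under intersection) and
the Weyl group. -/
@[ext]
structure FaceWeyl where
  face : D.Face
  elt : A.Weyl

/-- `(R, σ) (S, τ) = (R ∩ σ S, σ τ)`, with unit `(X, 1)`. -/
instance : Monoid D.FaceWeyl where
  mul p q := ⟨⟨p.face.1 ∩ D.act p.elt '' q.face.1, p.face.2.inter (q.face.2.image p.elt)⟩,
    p.elt * q.elt⟩
  one := ⟨⟨D.tits, D.isFace_tits⟩, 1⟩
  mul_assoc p q r := by
    refine FaceWeyl.ext (Subtype.ext ?_) (mul_assoc _ _ _)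
    change (p.face.1 ∩ D.act p.elt '' q.face.1) ∩ D.act (p.elt * q.elt) '' r.face.1 =
      p.face.1 ∩ D.act p.elt '' (q.face.1 ∩ D.act q.elt '' r.face.1)
    have hinj : Function.Injective (D.act (R := ℝ) p.elt) :=
      Function.LeftInverse.injective (D.act_inv_act p.elt)
    rw [image_inter hinj, image_image, inter_assoc]
    simp only [act_mul]
  one_mul p := by
    refine FaceWeyl.ext (Subtype.ext ?_) (one_mul _)
    change D.tits ∩ D.act 1 '' p.face.1 = p.face.1
    simp only [act_one, image_id']
    exact inter_eq_right.2 p.face.2.extreme.subset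
  mul_one p := by
    refine FaceWeyl.ext (Subtype.ext ?_) (mul_one _)
    change p.face.1 ∩ D.act p.elt '' D.tits = p.face.1
    refine inter_eq_left.2 fun x hx => ?_
    exact ⟨D.act p.elt⁻¹ x, D.act_mem_tits _ (p.face.2.extreme.subset hx), D.act_act_inv _ _⟩

/-- `Z_W(R)`, the pointwise stabilizer. -/
def pointStab (F : Set (H →ₗ[ℤ] ℝ)) : Set A.Weyl := {w | ∀ l ∈ F, D.act w l = l}

/-- The congruence `(R, σ) ∼ (R', σ')` iff `R = R'` and `σ' σ⁻¹ ∈ Z_W(R)`. -/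
def faceCon : Con D.FaceWeyl where
  r p q := p.face = q.face ∧ q.elt * p.elt⁻¹ ∈ D.pointStab p.face.1
  iseqv := by
    refine ⟨fun p => ⟨rfl, fun l _ => ?_⟩, ?_, ?_⟩
    · rw [mul_inv_cancel, act_one]
    · rintro p q ⟨h1, h2⟩
      refine ⟨h1.symm, fun l hl => ?_⟩
      have := h2 l (h1 ▸ hl)
      conv_lhs => rw [← this, ← act_mul]
      simp [act_one]
    · rintro p q r ⟨h1, h2⟩ ⟨h3, h4⟩
      refine ⟨h1.trans h3, fun l hl => ?_⟩
      have e : r.elt * p.elt⁻¹ = (r.elt * q.elt⁻¹) * (q.elt * p.elt⁻¹) := by group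
      rw [e, act_mul, h2 l hl, h4 l (h1 ▸ hl)]
  mul' := by
    rintro p p' q q' ⟨h1, h2⟩ ⟨h3, h4⟩
    have hs : ∀ l ∈ p.face.1, D.act p'.elt⁻¹ l = D.act p.elt⁻¹ l := by
      intro l hl
      have := congrArg (D.act p'.elt⁻¹) (h2 l hl)
      rw [← act_mul] at this
      rw [← this]
      congr 1
      group
    refine ⟨Subtype.ext ?_, ?_⟩
    · change p.face.1 ∩ D.act p.elt '' q.face.1 = p'.face.1 ∩ D.act p'.elt '' q'.face.1
      rw [← h1, ← h3]
      ext l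
      refine and_congr_right fun hl => ⟨?_, ?_⟩
      · rintro ⟨m, hm, rfl⟩
        have := hs _ hl
        rw [act_inv_act] at this
        refine ⟨m, hm, ?_⟩
        have t := congrArg (D.act p'.elt) this
        rw [act_act_inv] at t
        exact t.symm
      · rintro ⟨m, hm, rfl⟩
        have := hs _ hl
        rw [act_inv_act] at this
        exact ⟨m, hm, by conv_lhs => rw [this, act_act_inv]⟩
    · rintro l ⟨hl, m, hm, rfl⟩
      change D.act (p'.elt * q'.elt * (p.elt * q.elt)⁻¹) (D.act p.elt m) = D.act p.elt m
      have e : p'.elt * q'.elt * (p.elt * q.elt)⁻¹ =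
          p'.elt * ((q'.elt * q.elt⁻¹) * p.elt⁻¹) := by group
      have := hs _ hl
      rw [act_inv_act] at this
      rw [e, act_mul, act_mul, act_inv_act, h4 m hm]
      have t := congrArg (D.act p'.elt) this
      rw [act_act_inv] at t
      exact t.symm

/-- The Weyl monoid. -/
abbrev WeylMonoid : Type _ := D.faceCon.Quotient

/-- The class of `(R, σ)`. -/
def cls (F : D.Face) (w : A.Weyl) : D.WeylMonoid := D.faceCon.mk' ⟨F, w⟩

/-- The element `e(R)` of the Weyl monoid. -/
def e (F : D.Face) : D.WeylMonoid := D.cls F 1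

/-- The embedding of the Weyl group, `σ ↦ e(X) σ`. -/
def ofWeyl (w : A.Weyl) : D.WeylMonoid := D.cls ⟨D.tits, D.isFace_tits⟩ w

/-! ### Normal forms and extended length functions -/

/-- `x = w₁ e(R(Θ)) w₂` is in normal form I. -/
structure IsNormalFormI (x : D.WeylMonoid) (w₁ : A.Weyl) (Θ : Set ι) (w₂ : A.Weyl) : Prop where
  special : A.IsSpecial Θ
  left : w₁ ∈ A.minRight Θ
  right : w₂ ∈ A.minLeft (Θ ∪ A.perp Θ)
  eq : x = D.ofWeyl w₁ * D.e (D.R Θ) * D.ofWeyl w₂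

/-- `x = w₁ e(R(Θ)) w₂` is in normal form II. -/
structure IsNormalFormII (x : D.WeylMonoid) (w₁ : A.Weyl) (Θ : Set ι) (w₂ : A.Weyl) : Prop where
  special : A.IsSpecial Θ
  left : w₁ ∈ A.minRight (Θ ∪ A.perp Θ)
  right : w₂ ∈ A.minLeft Θ
  eq : x = D.ofWeyl w₁ * D.e (D.R Θ) * D.ofWeyl w₂

open Classical in
/-- `l₊₊(x) = l(w₁) - l(w₂)` for `x = w₁ e(R(Θ)) w₂` in normal form I. (Every element has exactly
one normal form I.) -/
noncomputable def lpp (x : D.WeylMonoid) : ℤ :=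
  if hx : ∃ t : A.Weyl × Set ι × A.Weyl, D.IsNormalFormI x t.1 t.2.1 t.2.2 then
    (A.cs.length hx.choose.1 : ℤ) - A.cs.length hx.choose.2.2
  else 0

open Classical in
/-- `l₋₋(x) = -l(w₁) + l(w₂)` for `x = w₁ e(R(Θ)) w₂` in normal form II. (Every element has exactly
one normal form II.) -/
noncomputable def lmm (x : D.WeylMonoid) : ℤ :=
  if hx : ∃ t : A.Weyl × Set ι × A.Weyl, D.IsNormalFormII x t.1 t.2.1 t.2.2 then
    -(A.cs.length hx.choose.1 : ℤ) + A.cs.length hx.choose.2.2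
  else 0

open Classical in
/-- `l₋₊(x) = l(w₁) + l(w₂)` for `x = w₁ e(R(Θ)) w₂` in normal form I or II. (The two normal forms
give the same value.) -/
noncomputable def lmp (x : D.WeylMonoid) : ℕ :=
  if hx : ∃ t : A.Weyl × Set ι × A.Weyl,
      D.IsNormalFormI x t.1 t.2.1 t.2.2 ∨ D.IsNormalFormII x t.1 t.2.1 t.2.2 then
    A.cs.length hx.choose.1 + A.cs.length hx.choose.2.2
  else 0

/-- `LengthRule f x y β S₊ S₀ S₋`: the function `f` satisfies
`f y = f x + 1` if `β ∈ S₊`, `f y = f x` if `β ∈ S₀`, `f y = f x - 1` if `β ∈ S₋`;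
one of these cases occurs; and `f y = f x` if and only if `y = x`. -/
structure LengthRule {M P : Type*} (f : M → ℤ) (x y : M) (β : P) (Splus Szero Sminus : Set P) :
    Prop where
  cases : β ∈ Splus ∨ β ∈ Szero ∨ β ∈ Sminus
  plus : β ∈ Splus → f y = f x + 1
  zero : β ∈ Szero → f y = f x
  minus : β ∈ Sminus → f y = f x - 1
  eq_iff : f y = f x ↔ y = x

end Realization

/-! Both normal forms refine to one decomposition `x = u a e(R(Θ)) w` with `u` minimal modulo `W_{Θ
∪ Θ^⊥}` on the right, `w` minimal on the left, and `a ∈ W_{Θ^⊥}` (`IsCentralForm`). Since `a`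
stabilizes `R(Θ)`, it may stand on either side: form I is `(u a, w)`, form II is `(u, a w)`. Lengths
add, so `l₊₊`, `l₋₋`, `l₋₊` are `l(u) + l(a) - l(w)`, `-l(u) + l(a) + l(w)`, `l(u) + l(a) + l(w)`.

For left multiplication by `σ_i`, either `σ_i u` is again minimal, or `σ_i u = u σ_j` with `u α_j =
α_i` and `j ∈ Θ ∪ Θ^⊥` (`simple_mul_mem_minRight_or`). In the first case only `u` changes; for `j ∈
Θ^⊥` only `a` changes; for `j ∈ Θ` the reflection is absorbed by `e(R(Θ))` and `x` is unchanged.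
Correspondingly `β = (u a)⁻¹ α_i` lies outside the roots of `W_{Θ ∪ Θ^⊥}`, among those of `W_{Θ^⊥}`,
or among those of `W_Θ`, and in the first two cases the sign of `β` is the change of length. Right
multiplication is the mirror image with `l₊₊` and `l₋₋` exchanged.

Two facts carry this. The first is the sign theorem: `w α_s` is a non-negative or a non-positive
combination of simple roots according to whether `σ_s` lengthens or shortens `w` (`nonneg_iff`,
`nonneg_neg_iff`); the theory of minimal coset representatives follows from it. The second is the
equality criterion `form_eq_iff`, which rests on the pointwise stabilizer `W_Θ` and the setwise
stabilizer `W_{Θ ∪ Θ^⊥}` of `R(Θ)`. For the latter, speciality of `Θ` supplies an antidominant `y =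
∑ c_i h_i` with positive coefficients exactly on `Θ` (`exists_antidominant`). The coefficients along
the orbit of `y` only grow (`exists_orbit`), so `y` is non-negative on the Tits cone, vanishes there
exactly on `R(Θ)`, and detects which `w` preserve that face. -/

namespace Realization

variable {ι : Type*} [Fintype ι] [DecidableEq ι] {A : SymmGCM ι}
  {H : Type*} [AddCommGroup H] [Module.Free ℤ H] [Module.Finite ℤ H] (D : Realization A H)

/-! ### Coefficients of elements of the root lattice -/

/-- The action of a Weyl group element on `Hom(H, R)` as an additive map. -/
def actHom {R : Type*} [AddCommGroup R] (w : A.Weyl) : (H →ₗ[ℤ] R) →+ (H →ₗ[ℤ] R) where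
  toFun := D.act w
  map_zero' := rfl
  map_add' _ _ := rfl

theorem act_add {R : Type*} [AddCommGroup R] (w : A.Weyl) (l m : H →ₗ[ℤ] R) :
    D.act w (l + m) = D.act w l + D.act w m := rfl

theorem act_sub {R : Type*} [AddCommGroup R] (w : A.Weyl) (l m : H →ₗ[ℤ] R) :
    D.act w (l - m) = D.act w l - D.act w m := rfl

theorem act_neg {R : Type*} [AddCommGroup R] (w : A.Weyl) (l : H →ₗ[ℤ] R) :
    D.act w (-l) = -D.act w l := rfl

theorem act_zero {R : Type*} [AddCommGroup R] (w : A.Weyl) :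
    D.act w (0 : H →ₗ[ℤ] R) = 0 := rfl

theorem act_zsmul {R : Type*} [AddCommGroup R] (w : A.Weyl) (n : ℤ) (l : H →ₗ[ℤ] R) :
    D.act w (n • l) = n • D.act w l := rfl

theorem act_sum {R : Type*} [AddCommGroup R] {κ : Type*} (s : Finset κ) (w : A.Weyl)
    (l : κ → H →ₗ[ℤ] R) : D.act w (∑ k ∈ s, l k) = ∑ k ∈ s, D.act w (l k) :=
  map_sum (D.actHom w) l s

theorem act_simple (i : ι) (l : Module.Dual ℤ H) :
    D.act (A.σ i) l = l - l (D.h i) • D.α i := by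
  ext x
  rw [act_simple_apply, LinearMap.sub_apply, LinearMap.smul_apply, smul_eq_mul, smul_eq_mul,
    mul_comm]

theorem act_simple_root (i j : ι) : D.act (A.σ i) (D.α j) = D.α j - A.a i j • D.α i := by
  rw [act_simple, D.pairing]

theorem act_simple_root_self (i : ι) : D.act (A.σ i) (D.α i) = -D.α i := by
  rw [act_simple_root, A.diag]
  module

/-- The element `∑ c_k α_k` of the root lattice. -/
def comb (c : ι → ℤ) : Module.Dual ℤ H := ∑ k, c k • D.α k

theorem comb_injective : Function.Injective D.comb := by
  intro c d h
  have hl := Fintype.linearIndependent_iff.1 D.indep_α (fun k => c k - d k) (by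
    simp only [sub_smul, Finset.sum_sub_distrib]
    exact sub_eq_zero.2 h)
  funext k
  exact sub_eq_zero.1 (hl k)

theorem comb_add (c d : ι → ℤ) : D.comb (c + d) = D.comb c + D.comb d := by
  simp [comb, add_smul, Finset.sum_add_distrib]

theorem comb_neg (c : ι → ℤ) : D.comb (-c) = -D.comb c := by
  simp [comb]

theorem comb_smul (n : ℤ) (c : ι → ℤ) : D.comb (n • c) = n • D.comb c := by
  simp [comb, Finset.smul_sum, mul_smul]

theorem comb_zero : D.comb 0 = 0 := by
  simp [comb]

theorem comb_single (i : ι) (n : ℤ) : D.comb (Pi.single i n) = n • D.α i := by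
  rw [comb, Finset.sum_eq_single i]
  · simp
  · intro k _ hk
    simp [Pi.single_eq_of_ne hk]
  · simp

theorem root_ne_zero (w : A.Weyl) (i : ι) : D.act w (D.α i) ≠ 0 := by
  intro h
  have h1 := D.act_inv_act w (D.α i)
  rw [h, act_zero] at h1
  exact D.indep_α.ne_zero i h1.symm

/-- `β` is a combination of the `α_k`, `k ∈ J`, with non-negative integral coefficients. -/
def NonnegOn (J : Set ι) (β : Module.Dual ℤ H) : Prop :=
  ∃ c : ι → ℤ, (∀ k, 0 ≤ c k) ∧ (∀ k ∉ J, c k = 0) ∧ D.comb c = β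

variable {D} in
theorem NonnegOn.mono {J K : Set ι} (h : J ⊆ K) {β : Module.Dual ℤ H} (hb : D.NonnegOn J β) :
    D.NonnegOn K β := by
  obtain ⟨c, h0, h1, h2⟩ := hb
  exact ⟨c, h0, fun k hk => h1 k fun hj => hk (h hj), h2⟩

variable {D} in
theorem NonnegOn.add {J : Set ι} {β γ : Module.Dual ℤ H} (hb : D.NonnegOn J β)
    (hc : D.NonnegOn J γ) : D.NonnegOn J (β + γ) := by
  obtain ⟨c, h0, h1, rfl⟩ := hb
  obtain ⟨d, g0, g1, rfl⟩ := hc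
  exact ⟨c + d, fun k => add_nonneg (h0 k) (g0 k), fun k hk => by simp [h1 k hk, g1 k hk],
    D.comb_add c d⟩

variable {D} in
theorem NonnegOn.zsmul {J : Set ι} {β : Module.Dual ℤ H} (hb : D.NonnegOn J β) {n : ℤ}
    (hn : 0 ≤ n) : D.NonnegOn J (n • β) := by
  obtain ⟨c, h0, h1, rfl⟩ := hb
  exact ⟨n • c, fun k => mul_nonneg hn (h0 k), fun k hk => by simp [h1 k hk], D.comb_smul n c⟩

theorem nonnegOn_zero (J : Set ι) : D.NonnegOn J 0 :=
  ⟨0, fun _ => le_rfl, fun _ _ => rfl, D.comb_zero⟩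

theorem nonnegOn_simple {J : Set ι} {j : ι} (hj : j ∈ J) : D.NonnegOn J (D.α j) := by
  refine ⟨Pi.single j 1, fun k => ?_, fun k hk => ?_, ?_⟩
  · exact (Pi.single_nonneg (α := fun _ : ι => ℤ) (i := j)).2 zero_le_one k
  · exact Pi.single_eq_of_ne (fun h : k = j => hk (h ▸ hj)) _
  · rw [comb_single, one_smul]

theorem nonnegOn_sum {J : Set ι} {κ : Type*} (s : Finset κ) (f : κ → Module.Dual ℤ H)
    (h : ∀ k ∈ s, D.NonnegOn J (f k)) : D.NonnegOn J (∑ k ∈ s, f k) :=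
  Finset.sum_induction f _ (fun _ _ => NonnegOn.add) (D.nonnegOn_zero J) h

variable {D} in
theorem NonnegOn.eq_zero {J K : Set ι} {β : Module.Dual ℤ H} (hb : D.NonnegOn J β)
    (hc : D.NonnegOn K (-β)) : β = 0 := by
  obtain ⟨c, h0, h1, rfl⟩ := hb
  obtain ⟨d, g0, g1, h⟩ := hc
  rw [← comb_neg] at h
  have h := D.comb_injective h
  have : c = 0 := by
    funext k
    have h2 := congrFun h k
    have h3 := h0 k
    have h4 := g0 k
    simp only [Pi.neg_apply] at h2
    simp only [Pi.zero_apply]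
    omega
  rw [this, comb_zero]

theorem mem_Qpos_iff (β : Module.Dual ℤ H) : β ∈ D.Qpos ↔ D.NonnegOn univ β := by
  constructor
  · intro h
    induction h using AddSubmonoid.closure_induction with
    | mem x hx =>
      obtain ⟨i, rfl⟩ := hx
      exact D.nonnegOn_simple (mem_univ i)
    | zero => exact D.nonnegOn_zero _
    | add x y _ _ hx hy => exact hx.add hy
  · rintro ⟨c, h0, -, rfl⟩
    refine AddSubmonoid.sum_mem _ fun k _ => ?_
    obtain ⟨n, hn⟩ := Int.eq_ofNat_of_zero_le (h0 k)
    rw [hn, natCast_zsmul]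
    exact AddSubmonoid.nsmul_mem _ (AddSubmonoid.subset_closure (mem_range_self k)) n

/-! ### Sign of the images of the simple roots -/

theorem act_simple_left (i j : ι) (x y : ℤ) :
    D.act (A.σ i) (x • D.α i + y • D.α j) = (-x - A.a i j * y) • D.α i + y • D.α j := by
  rw [act_add, act_zsmul, act_zsmul, act_simple_root_self, act_simple_root]
  module

theorem act_simple_right (i j : ι) (x y : ℤ) :
    D.act (A.σ j) (x • D.α i + y • D.α j) = x • D.α i + (-y - A.a j i * x) • D.α j := by
  rw [act_add, act_zsmul, act_zsmul, act_simple_root_self, act_simple_root]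
  module

open CoxeterSystem in
theorem act_alternatingWord_succ (s t : ι) (n : ℕ) (l : Module.Dual ℤ H) :
    D.act (A.cs.wordProd (alternatingWord s t (n + 1))) l =
      D.act (A.σ (if Even n then t else s)) (D.act (A.cs.wordProd (alternatingWord s t n)) l) := by
  rw [alternatingWord_succ', wordProd_cons, act_mul]

theorem coxeterMatrix_apply (i j : ι) : A.coxeterMatrix i j = if i = j then 1
    else if A.a i j * A.a j i = 0 then 2
    else if A.a i j * A.a j i = 1 then 3
    else if A.a i j * A.a j i = 2 then 4
    else if A.a i j * A.a j i = 3 then 6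
    else 0 := rfl

open CoxeterSystem in
-- The conditional inequality drives the induction: the current vector pairs non-negatively with the
-- coroot of the letter applied last (`s` for the empty word). Multiplied by minus the other Cartan
-- entry and combined with `4 ≤ a_st a_ts`, it shows that the coefficient about to be replaced does
-- not decrease.
theorem alternatingWord_nonneg_of_four_le {s t : ι} (hst : s ≠ t)
    (hp : 4 ≤ A.a s t * A.a t s) (n : ℕ) :
    ∃ x y : ℤ, 0 ≤ x ∧ 0 ≤ y ∧
      (if Even n then -A.a s t * y ≤ 2 * x else -A.a t s * x ≤ 2 * y) ∧
      D.act (A.cs.wordProd (alternatingWord s t n)) (D.α s) = x • D.α s + y • D.α t := by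
  have h1 := A.off_diag s t hst
  have h2 := A.off_diag t s hst.symm
  induction n with
  | zero => exact ⟨1, 0, by simp, by simp, by simp, by simp [alternatingWord, act_one]⟩
  | succ n ih =>
    obtain ⟨x, y, hx, hy, hxy, e⟩ := ih
    rw [act_alternatingWord_succ, e]
    rcases Nat.even_or_odd n with hn | hn
    · rw [if_pos hn] at hxy ⊢
      have hn' : ¬ Even (n + 1) := Nat.not_even_iff_odd.2 hn.add_one
      have h3 : 2 * y ≤ -A.a t s * x := by nlinarith
      refine ⟨x, -y - A.a t s * x, hx, by linarith, ?_, D.act_simple_right s t x y⟩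
      rw [if_neg hn']
      linarith
    · have hn' := Nat.not_even_iff_odd.2 hn
      rw [if_neg hn'] at hxy ⊢
      have h3 : 2 * x ≤ -A.a s t * y := by nlinarith
      refine ⟨-x - A.a s t * y, y, by linarith, hy, ?_, D.act_simple_left s t x y⟩
      rw [if_pos hn.add_one]
      linarith

open CoxeterSystem in
-- For `P = a_st a_ts ≤ 3` the exponent is at most `6`, so six vectors suffice. Their coefficients
-- are polynomials in `P`, up to the factor `-a_ts ≥ 0`, and the bound on `n` stops just before a
-- sign change.
theorem alternatingWord_nonneg {s t : ι} (hst : s ≠ t) (n : ℕ)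
    (hn : A.coxeterMatrix s t = 0 ∨ n < A.coxeterMatrix s t) :
    ∃ x y : ℤ, 0 ≤ x ∧ 0 ≤ y ∧
      D.act (A.cs.wordProd (alternatingWord s t n)) (D.α s) = x • D.α s + y • D.α t := by
  have h1 := A.off_diag s t hst
  have h2 := A.off_diag t s hst.symm
  by_cases hp : 4 ≤ A.a s t * A.a t s
  · obtain ⟨x, y, hx, hy, -, e⟩ := D.alternatingWord_nonneg_of_four_le hst hp n
    exact ⟨x, y, hx, hy, e⟩
  have hp0 : 0 ≤ A.a s t * A.a t s := mul_nonneg_of_nonpos_of_nonpos h1 h2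
  set P := A.a s t * A.a t s with hP
  have e0 : D.act (A.cs.wordProd (alternatingWord s t 0)) (D.α s) =
      (1 : ℤ) • D.α s + (0 : ℤ) • D.α t := by simp [alternatingWord, act_one]
  have e1 : D.act (A.cs.wordProd (alternatingWord s t 1)) (D.α s) =
      (1 : ℤ) • D.α s + (-A.a t s) • D.α t := by
    rw [act_alternatingWord_succ, e0, if_pos (by decide), act_simple_right]
    congr 2
    ring
  have e2 : D.act (A.cs.wordProd (alternatingWord s t 2)) (D.α s) =
      (P - 1) • D.α s + (-A.a t s) • D.α t := by
    rw [act_alternatingWord_succ, e1, if_neg (by decide), act_simple_left]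
    congr 2
    rw [hP]
    ring
  have e3 : D.act (A.cs.wordProd (alternatingWord s t 3)) (D.α s) =
      (P - 1) • D.α s + (-A.a t s * (P - 2)) • D.α t := by
    rw [act_alternatingWord_succ, e2, if_pos (by decide), act_simple_right]
    congr 2
    ring
  have e4 : D.act (A.cs.wordProd (alternatingWord s t 4)) (D.α s) =
      (P ^ 2 - 3 * P + 1) • D.α s + (-A.a t s * (P - 2)) • D.α t := by
    rw [act_alternatingWord_succ, e3, if_neg (by decide), act_simple_left]
    congr 2
    rw [hP]
    ring
  have e5 : D.act (A.cs.wordProd (alternatingWord s t 5)) (D.α s) =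
      (P ^ 2 - 3 * P + 1) • D.α s + (-A.a t s * (P ^ 2 - 4 * P + 3)) • D.α t := by
    rw [act_alternatingWord_succ, e4, if_pos (by decide), act_simple_right]
    congr 2
    ring
  have hM := coxeterMatrix_apply (A := A) s t
  rw [← hP, if_neg hst] at hM
  have hq : 0 ≤ -A.a t s := by linarith
  obtain hP' | hP' | hP' | hP' : P = 0 ∨ P = 1 ∨ P = 2 ∨ P = 3 := by omega
  all_goals
    rw [hP'] at hM e2 e3 e4 e5
    norm_num at hM e2 e3 e4 e5
    rw [hM] at hn
    norm_num at hn
    interval_cases n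
  all_goals first
    | exact ⟨_, _, by norm_num, by norm_num, e0⟩
    | exact ⟨_, _, by norm_num, hq, e1⟩
    | exact ⟨1, -A.a t s, by norm_num, hq, by rw [e2]; module⟩
    | exact ⟨0, -A.a t s, by norm_num, hq, by rw [e2]; module⟩
    | exact ⟨2, -A.a t s, by norm_num, hq, by rw [e2]; module⟩
    | exact ⟨1, 0, by norm_num, by norm_num, by rw [e3]; module⟩
    | exact ⟨2, -A.a t s, by norm_num, hq, by rw [e3]; module⟩
    | exact ⟨1, -A.a t s, by norm_num, hq, by rw [e4]; module⟩
    | exact ⟨1, 0, by norm_num, by norm_num, by rw [e5]; module⟩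

open CoxeterSystem in
-- Induction on length by reduction to rank two. Some `t ≠ s` is a right descent of `w`. An
-- alternating word in `s`, `t` ending in `t` is split off from the right, with lengths adding,
-- until it cannot be lengthened; the remaining `v` has neither `s` nor `t` as a right descent. The
-- induction hypothesis covers `v α_s` and `v α_t`, and the word sends `α_s` to a non-negative
-- combination of `α_s` and `α_t`.
theorem nonneg_of_not_isRightDescent (w : A.Weyl) (s : ι) (hs : ¬ A.cs.IsRightDescent w s) :
    D.NonnegOn univ (D.act w (D.α s)) := by
  induction hN : A.cs.length w using Nat.strong_induction_on generalizing w s with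
  | _ N ih =>
  subst hN
  by_cases hw : w = 1
  · rw [hw, act_one]
    exact D.nonnegOn_simple (mem_univ s)
  obtain ⟨t, ht⟩ := A.cs.exists_rightDescent_of_ne_one hw
  have hst : s ≠ t := fun h => hs (h ▸ ht)
  have hs' := A.cs.not_isRightDescent_iff.1 hs
  have ht' := A.cs.isRightDescent_iff.1 ht
  let Q : ℕ → Prop := fun n => ∃ v, w = v * A.cs.wordProd (alternatingWord s t n) ∧
    A.cs.length w = A.cs.length v + n
  have hQ1 : Q 1 := ⟨w * A.cs.simple t, by
    rw [show alternatingWord s t 1 = [t] from rfl, wordProd_singleton,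
      simple_mul_simple_cancel_right], by omega⟩
  obtain ⟨n, hn1, hQn, hQn'⟩ : ∃ n, 1 ≤ n ∧ Q n ∧ ¬ Q (n + 1) := by
    by_contra! hcon
    have hall : ∀ n, 1 ≤ n → Q n := by
      intro n hn
      induction n, hn using Nat.le_induction with
      | base => exact hQ1
      | succ n hn hq => exact hcon n hn hq
    obtain ⟨v, -, h⟩ := hall (A.cs.length w + 1) (by omega)
    omega
  obtain ⟨v, hv, hl⟩ := hQn
  have hlt : A.cs.length v < A.cs.length w := by omega
  have hpos1 : ¬ A.cs.IsRightDescent v (if Even n then t else s) := by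
    intro hd
    have hd' := A.cs.isRightDescent_iff.1 hd
    refine hQn' ⟨v * A.cs.simple (if Even n then t else s), ?_, by omega⟩
    rw [alternatingWord_succ', wordProd_cons, mul_assoc, simple_mul_simple_cancel_left]
    exact hv
  -- A descent of `v` at the first letter of the alternating word would cancel that letter and make
  -- `w` shorter than `l(v) + n`.
  have hpos2 : ¬ A.cs.IsRightDescent v (if Even n then s else t) := by
    intro hd
    have hd' := A.cs.isRightDescent_iff.1 hd
    obtain ⟨m, rfl⟩ : ∃ m, n = m + 1 := ⟨n - 1, by omega⟩
    rw [alternatingWord_succ', wordProd_cons, ← mul_assoc] at hv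
    have hc : (if Even m then t else s) = (if Even (m + 1) then s else t) := by
      by_cases h : Even m <;> simp [h, Nat.even_add_one]
    rw [hc] at hv
    have h1 := A.cs.length_mul_le (v * A.cs.simple (if Even (m + 1) then s else t))
      (A.cs.wordProd (alternatingWord s t m))
    have h2 := A.cs.length_wordProd_le (alternatingWord s t m)
    rw [length_alternatingWord] at h2
    rw [← hv] at h1
    omega
  have hvs : D.NonnegOn univ (D.act v (D.α s)) := by
    by_cases h : Even n
    · exact ih _ hlt v s (by simpa [h] using hpos2) rfl
    · exact ih _ hlt v s (by simpa [h] using hpos1) rfl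
  have hvt : D.NonnegOn univ (D.act v (D.α t)) := by
    by_cases h : Even n
    · exact ih _ hlt v t (by simpa [h] using hpos1) rfl
    · exact ih _ hlt v t (by simpa [h] using hpos2) rfl
  -- From the Coxeter exponent on, the alternating word of length `n + 1` ending in `s` is not
  -- reduced, so `l(w σ_s) ≤ l(w)`, against `hs`.
  have hM : A.coxeterMatrix s t = 0 ∨ n < A.coxeterMatrix s t := by
    by_contra! hcon
    have hred := A.cs.not_isReduced_alternatingWord t s (m := n + 1)
      (by rw [A.coxeterMatrix.symmetric]; exact hcon.1)
      (by rw [A.coxeterMatrix.symmetric]; omega)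
    have h2 := A.cs.length_wordProd_le (alternatingWord t s (n + 1))
    have h3 : A.cs.length (A.cs.wordProd (alternatingWord t s (n + 1))) ≠ n + 1 := by
      intro h
      exact hred (by rw [CoxeterSystem.IsReduced, h, length_alternatingWord])
    rw [length_alternatingWord] at h2
    have h4 : w * A.cs.simple s = v * A.cs.wordProd (alternatingWord t s (n + 1)) := by
      rw [alternatingWord_succ, wordProd_concat, ← mul_assoc, ← hv]
    have h5 := A.cs.length_mul_le v (A.cs.wordProd (alternatingWord t s (n + 1)))
    rw [← h4] at h5
    omega
  obtain ⟨x, y, hx, hy, e⟩ := D.alternatingWord_nonneg hst n hM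
  rw [hv, act_mul, e, act_add, act_zsmul, act_zsmul]
  exact (hvs.zsmul hx).add (hvt.zsmul hy)

theorem nonneg_neg_of_isRightDescent (w : A.Weyl) (s : ι) (hs : A.cs.IsRightDescent w s) :
    D.NonnegOn univ (-D.act w (D.α s)) := by
  have h := D.nonneg_of_not_isRightDescent (w * A.σ s) s
    (A.cs.isRightDescent_iff_not_isRightDescent_mul.1 hs)
  rwa [act_mul, act_simple_root_self, act_neg] at h

theorem nonneg_iff (w : A.Weyl) (s : ι) :
    D.NonnegOn univ (D.act w (D.α s)) ↔ ¬ A.cs.IsRightDescent w s :=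
  ⟨fun h hs => D.root_ne_zero w s (h.eq_zero (D.nonneg_neg_of_isRightDescent w s hs)),
    D.nonneg_of_not_isRightDescent w s⟩

theorem nonneg_neg_iff (w : A.Weyl) (s : ι) :
    D.NonnegOn univ (-D.act w (D.α s)) ↔ A.cs.IsRightDescent w s :=
  ⟨fun h => by_contra fun hs =>
    D.root_ne_zero w s ((D.nonneg_of_not_isRightDescent w s hs).eq_zero h),
    D.nonneg_neg_of_isRightDescent w s⟩

end Realization

/-! ### Standard parabolic subgroups -/

namespace SymmGCM

variable {ι : Type*} [Fintype ι] [DecidableEq ι] (A : SymmGCM ι)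

theorem simple_mem_parabolic {J : Set ι} {j : ι} (hj : j ∈ J) : A.σ j ∈ A.parabolic J :=
  Subgroup.subset_closure (mem_image_of_mem _ hj)

theorem parabolic_mono {J K : Set ι} (h : J ⊆ K) : A.parabolic J ≤ A.parabolic K :=
  Subgroup.closure_mono (image_mono h)

@[elab_as_elim]
theorem parabolic_induction {J : Set ι} {p : (v : A.Weyl) → v ∈ A.parabolic J → Prop}
    (one : p 1 (one_mem _))
    (mul : ∀ v (hv : v ∈ A.parabolic J) j (hj : j ∈ J), p v hv →
      p (v * A.σ j) (mul_mem hv (A.simple_mem_parabolic hj)))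
    {v : A.Weyl} (hv : v ∈ A.parabolic J) : p v hv := by
  induction hv using Subgroup.closure_induction_right with
  | one => exact one
  | mul_right x hx y hy ih =>
    obtain ⟨j, hj, rfl⟩ := hy
    exact mul x hx j hj ih
  | mul_inv_cancel x hx y hy ih =>
    obtain ⟨j, hj, rfl⟩ := hy
    have := mul x hx j hj ih
    simpa only [CoxeterSystem.inv_simple] using this

end SymmGCM

namespace Realization

variable {ι : Type*} [Fintype ι] [DecidableEq ι] {A : SymmGCM ι}
  {H : Type*} [AddCommGroup H] [Module.Free ℤ H] [Module.Finite ℤ H] (D : Realization A H)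

/-- Membership in the span of the `α_k`, `k ∈ J`, in terms of coefficients. -/
def SpanOn (J : Set ι) (β : Module.Dual ℤ H) : Prop :=
  ∃ c : ι → ℤ, (∀ k ∉ J, c k = 0) ∧ D.comb c = β

variable {D} in
theorem NonnegOn.spanOn {J : Set ι} {β : Module.Dual ℤ H} (h : D.NonnegOn J β) : D.SpanOn J β := by
  obtain ⟨c, -, h1, h2⟩ := h
  exact ⟨c, h1, h2⟩

variable {D} in
theorem SpanOn.add {J : Set ι} {β γ : Module.Dual ℤ H} (hb : D.SpanOn J β)
    (hc : D.SpanOn J γ) : D.SpanOn J (β + γ) := by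
  obtain ⟨c, h1, rfl⟩ := hb
  obtain ⟨d, g1, rfl⟩ := hc
  exact ⟨c + d, fun k hk => by simp [h1 k hk, g1 k hk], D.comb_add c d⟩

variable {D} in
theorem SpanOn.zsmul {J : Set ι} {β : Module.Dual ℤ H} (hb : D.SpanOn J β) (n : ℤ) :
    D.SpanOn J (n • β) := by
  obtain ⟨c, h1, rfl⟩ := hb
  exact ⟨n • c, fun k hk => by simp [h1 k hk], D.comb_smul n c⟩

variable {D} in
theorem SpanOn.neg {J : Set ι} {β : Module.Dual ℤ H} (hb : D.SpanOn J β) : D.SpanOn J (-β) := by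
  simpa using hb.zsmul (-1)

variable {D} in
theorem SpanOn.nonnegOn {J : Set ι} {β : Module.Dual ℤ H} (hb : D.SpanOn J β)
    (h : D.NonnegOn univ β) : D.NonnegOn J β := by
  obtain ⟨c, h1, rfl⟩ := hb
  obtain ⟨d, g0, -, g2⟩ := h
  rw [D.comb_injective g2] at g0
  exact ⟨c, g0, h1, rfl⟩

theorem spanOn_act_sub {J : Set ι} {v : A.Weyl} (hv : v ∈ A.parabolic J) (l : Module.Dual ℤ H) :
    D.SpanOn J (D.act v l - l) := by
  induction hv using SymmGCM.parabolic_induction generalizing l with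
  | one => simpa [act_one] using (D.nonnegOn_zero J).spanOn
  | mul v hv j hj ih =>
    have hα := (ih (D.α j)).add (D.nonnegOn_simple hj).spanOn
    rw [sub_add_cancel] at hα
    have e : D.act (v * A.σ j) l - l = (D.act v l - l) + (-l (D.h j)) • D.act v (D.α j) := by
      rw [act_mul, act_simple, act_sub, act_zsmul]
      module
    rw [e]
    exact (ih l).add (hα.zsmul _)

theorem spanOn_act {J : Set ι} {v : A.Weyl} (hv : v ∈ A.parabolic J) {l : Module.Dual ℤ H}
    (hl : D.SpanOn J l) : D.SpanOn J (D.act v l) := by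
  simpa using (D.spanOn_act_sub hv l).add hl

theorem nonneg_or_nonneg_neg (w : A.Weyl) (s : ι) :
    D.NonnegOn univ (D.act w (D.α s)) ∨ D.NonnegOn univ (-D.act w (D.α s)) := by
  by_cases h : A.cs.IsRightDescent w s
  · exact Or.inr (D.nonneg_neg_of_isRightDescent w s h)
  · exact Or.inl (D.nonneg_of_not_isRightDescent w s h)

theorem parabolic_nonneg_or_nonneg_neg {J : Set ι} {v : A.Weyl} (hv : v ∈ A.parabolic J)
    {j : ι} (hj : j ∈ J) :
    D.NonnegOn J (D.act v (D.α j)) ∨ D.NonnegOn J (-D.act v (D.α j)) := by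
  have h := D.spanOn_act hv (D.nonnegOn_simple hj).spanOn
  exact (D.nonneg_or_nonneg_neg v j).imp h.nonnegOn h.neg.nonnegOn

include D in
-- The coefficient of `α_k` in `w α_k` is `1`, so this root is not negative.
theorem not_isRightDescent_of_act_eq {w : A.Weyl} {J : Set ι} {k : ι} (hk : k ∉ J)
    (h : D.SpanOn J (D.act w (D.α k) - D.α k)) : ¬ A.cs.IsRightDescent w k := by
  intro hd
  obtain ⟨c, h1, h2⟩ := h
  obtain ⟨d, g0, -, g2⟩ := D.nonneg_neg_of_isRightDescent w k hd
  have e : D.comb (-d) = D.comb (c + Pi.single k 1) := by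
    rw [comb_neg, g2, comb_add, h2, comb_single]
    module
  have h3 := congrFun (D.comb_injective e) k
  simp only [Pi.neg_apply, Pi.add_apply, Pi.single_eq_same, h1 k hk] at h3
  have h4 := g0 k
  omega

include D in
theorem not_isRightDescent_of_notMem {J : Set ι} {v : A.Weyl} (hv : v ∈ A.parabolic J) {k : ι}
    (hk : k ∉ J) : ¬ A.cs.IsRightDescent v k :=
  D.not_isRightDescent_of_act_eq hk (D.spanOn_act_sub hv _)

include D in
theorem parabolic_disjoint {J K : Set ι} (hJK : Disjoint J K) {v : A.Weyl}
    (hJ : v ∈ A.parabolic J) (hK : v ∈ A.parabolic K) : v = 1 := by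
  by_contra hne
  obtain ⟨k, hk⟩ := A.cs.exists_rightDescent_of_ne_one hne
  have h1 : k ∈ J := by_contra fun h => D.not_isRightDescent_of_notMem hJ h hk
  have h2 : k ∈ K := by_contra fun h => D.not_isRightDescent_of_notMem hK h hk
  exact Set.disjoint_left.1 hJK h1 h2

/-! ### Minimal coset representatives -/

theorem act_nonneg_of_forall_not_isRightDescent {J : Set ι} {w : A.Weyl}
    (hw : ∀ j ∈ J, ¬ A.cs.IsRightDescent w j) {β : Module.Dual ℤ H} (hb : D.NonnegOn J β) :
    D.NonnegOn univ (D.act w β) := by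
  obtain ⟨c, h0, h1, rfl⟩ := hb
  rw [comb, act_sum]
  refine D.nonnegOn_sum _ _ fun k _ => ?_
  rw [act_zsmul]
  by_cases hk : k ∈ J
  · exact (D.nonneg_of_not_isRightDescent w k (hw k hk)).zsmul (h0 k)
  · rw [h1 k hk, zero_smul]
    exact D.nonnegOn_zero _

include D in
-- Such a `w` preserves non-negativity of combinations of the `α_j`, `j ∈ J`. Hence `v α_j` and `w v
-- α_j` have the same sign, and appending `σ_j` changes both lengths equally; the expression of `v`
-- in generators need not be reduced.
theorem length_mul_of_forall_not_isRightDescent {J : Set ι} {w : A.Weyl}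
    (hw : ∀ j ∈ J, ¬ A.cs.IsRightDescent w j) {v : A.Weyl} (hv : v ∈ A.parabolic J) :
    A.cs.length (w * v) = A.cs.length w + A.cs.length v := by
  induction hv using SymmGCM.parabolic_induction with
  | one => simp
  | mul v hv j hj ih =>
    rcases D.parabolic_nonneg_or_nonneg_neg hv hj with h | h
    · have h1 := D.act_nonneg_of_forall_not_isRightDescent hw h
      rw [← act_mul] at h1
      have h2 := A.cs.not_isRightDescent_iff.1 ((D.nonneg_iff _ _).1 h1)
      have h3 := A.cs.not_isRightDescent_iff.1
        ((D.nonneg_iff _ _).1 (h.mono (subset_univ _)))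
      rw [← mul_assoc]
      change A.cs.length (w * v * A.cs.simple j) = _ + A.cs.length (v * A.cs.simple j)
      omega
    · have h1 := D.act_nonneg_of_forall_not_isRightDescent hw h
      rw [act_neg, ← act_mul] at h1
      have h2 := A.cs.isRightDescent_iff.1 ((D.nonneg_neg_iff _ _).1 h1)
      have h3 := A.cs.isRightDescent_iff.1
        ((D.nonneg_neg_iff _ _).1 (h.mono (subset_univ _)))
      rw [← mul_assoc]
      change A.cs.length (w * v * A.cs.simple j) = _ + A.cs.length (v * A.cs.simple j)
      omega

include D in
theorem mem_minRight_iff {J : Set ι} {w : A.Weyl} :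
    w ∈ A.minRight J ↔ ∀ j ∈ J, ¬ A.cs.IsRightDescent w j := by
  constructor
  · intro h j hj hd
    exact absurd (h _ (A.simple_mem_parabolic hj)) (not_le.2 hd)
  · intro h v hv
    rw [D.length_mul_of_forall_not_isRightDescent h hv]
    omega

theorem inv_mem_minRight_iff {J : Set ι} {w : A.Weyl} : w⁻¹ ∈ A.minRight J ↔ w ∈ A.minLeft J := by
  constructor
  · intro h v hv
    have := h v⁻¹ (inv_mem hv)
    rwa [← mul_inv_rev, CoxeterSystem.length_inv, CoxeterSystem.length_inv] at this
  · intro h v hv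
    have := h v⁻¹ (inv_mem hv)
    rwa [← CoxeterSystem.length_inv, ← CoxeterSystem.length_inv (w := v⁻¹ * w), mul_inv_rev,
      inv_inv] at this

include D in
theorem length_mul_of_mem_minRight {J : Set ι} {w v : A.Weyl} (hw : w ∈ A.minRight J)
    (hv : v ∈ A.parabolic J) : A.cs.length (w * v) = A.cs.length w + A.cs.length v :=
  D.length_mul_of_forall_not_isRightDescent (D.mem_minRight_iff.1 hw) hv

include D in
theorem length_mul_of_mem_minLeft {J : Set ι} {w v : A.Weyl} (hw : w ∈ A.minLeft J)
    (hv : v ∈ A.parabolic J) : A.cs.length (v * w) = A.cs.length v + A.cs.length w := by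
  have h := D.length_mul_of_mem_minRight (inv_mem_minRight_iff.2 hw) (inv_mem hv)
  rwa [← mul_inv_rev, CoxeterSystem.length_inv, CoxeterSystem.length_inv,
    CoxeterSystem.length_inv, add_comm] at h

include D in
theorem eq_of_mem_minRight {J : Set ι} {w w' : A.Weyl} (hw : w ∈ A.minRight J)
    (hw' : w' ∈ A.minRight J) (h : w⁻¹ * w' ∈ A.parabolic J) : w = w' := by
  have h1 := D.length_mul_of_mem_minRight hw h
  have h2 := D.length_mul_of_mem_minRight hw' (inv_mem h)
  rw [CoxeterSystem.length_inv, mul_inv_rev, inv_inv, mul_inv_cancel_left] at h2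
  rw [mul_inv_cancel_left] at h1
  have h3 : A.cs.length (w⁻¹ * w') = 0 := by omega
  exact inv_mul_eq_one.1 (A.cs.length_eq_zero_iff.1 h3)

include D in
theorem eq_of_mem_minLeft {J : Set ι} {w w' : A.Weyl} (hw : w ∈ A.minLeft J)
    (hw' : w' ∈ A.minLeft J) (h : w * w'⁻¹ ∈ A.parabolic J) : w = w' :=
  inv_injective (D.eq_of_mem_minRight (inv_mem_minRight_iff.2 hw) (inv_mem_minRight_iff.2 hw')
    (by rwa [inv_inv]))

theorem exists_minRight_mul (J : Set ι) (w : A.Weyl) :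
    ∃ u ∈ A.minRight J, ∃ v ∈ A.parabolic J, w = u * v := by
  obtain ⟨v, hv, hmin⟩ := WellFounded.has_min (measure fun v => A.cs.length (w * v)).wf
    (A.parabolic J : Set A.Weyl) ⟨1, one_mem _⟩
  refine ⟨w * v, fun v' hv' => ?_, v⁻¹, inv_mem hv, by group⟩
  have := hmin (v * v') (mul_mem hv hv')
  rw [mul_assoc]
  exact not_lt.1 this

include D in
-- Nothing is needed about coroots: `u σ_j u⁻¹ σ_i` fixes `α_i` and moves every other simple root by
-- a multiple of `α_i`, so it has no right descent and equals `1`.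
theorem simple_mul_eq_mul_simple {u : A.Weyl} {i j : ι} (h : D.act u (D.α j) = D.α i) :
    A.σ i * u = u * A.σ j := by
  have hinv : D.act u⁻¹ (D.α i) = D.α j := by rw [← h, act_inv_act]
  have hg : ∀ k, ∃ m : ℤ, D.act (u * A.σ j * u⁻¹ * A.σ i) (D.α k) = D.α k + m • D.α i := by
    intro k
    refine ⟨A.a i k - D.act u⁻¹ (D.α k) (D.h j), ?_⟩
    rw [act_mul, act_mul, act_mul, act_simple_root, act_sub, act_zsmul, hinv, act_sub, act_sub,
      act_zsmul, act_zsmul, act_simple_root_self, act_neg, h, act_simple, act_sub, act_zsmul, h,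
      act_act_inv]
    module
  have h1 : u * A.σ j * u⁻¹ * A.σ i = 1 := by
    by_contra hne
    obtain ⟨k, hk⟩ := A.cs.exists_rightDescent_of_ne_one hne
    by_cases hki : k = i
    · subst hki
      refine (D.nonneg_iff _ k).1 ?_ hk
      rw [act_mul, act_mul, act_mul, act_simple_root_self, act_neg, hinv, act_neg,
        act_simple_root_self, neg_neg, h]
      exact D.nonnegOn_simple (mem_univ k)
    · obtain ⟨m, hm⟩ := hg k
      refine D.not_isRightDescent_of_act_eq (J := {i}) (k := k) hki ?_ hk
      rw [hm, add_sub_cancel_left]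
      exact (D.nonnegOn_simple (mem_singleton i)).spanOn.zsmul m
  have h2 : u * A.σ j * u⁻¹ = A.σ i := by
    rw [mul_eq_one_iff_eq_inv.1 h1]
    exact A.cs.inv_simple i
  rw [← h2, inv_mul_cancel_right]

theorem exists_comb_eq_root (w : A.Weyl) (i : ι) : ∃ c : ι → ℤ, D.comb c = D.act w (D.α i) := by
  rcases D.nonneg_or_nonneg_neg w i with ⟨c, -, -, h⟩ | ⟨c, -, -, h⟩
  · exact ⟨c, h⟩
  · exact ⟨-c, by rw [comb_neg, h, neg_neg]⟩

/-- A minimal coset representative stays minimal after left multiplication by a simple reflection,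
or the simple reflection can be moved through it. -/
theorem simple_mul_mem_minRight_or {J : Set ι} {u : A.Weyl} (hu : u ∈ A.minRight J) (i : ι) :
    A.σ i * u ∈ A.minRight J ∨ ∃ j ∈ J, D.act u (D.α j) = D.α i ∧ A.σ i * u = u * A.σ j := by
  by_contra! hcon
  obtain ⟨h1, h2⟩ := hcon
  rw [D.mem_minRight_iff] at h1
  push Not at h1
  obtain ⟨j, hj, hd⟩ := h1
  suffices h : D.act u (D.α j) = D.α i from h2 j hj h (D.simple_mul_eq_mul_simple h)
  obtain ⟨c, c0, -, hc⟩ := D.nonneg_of_not_isRightDescent u j (D.mem_minRight_iff.1 hu j hj)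
  obtain ⟨d, d0, -, hd⟩ := D.nonneg_neg_of_isRightDescent _ j hd
  rw [act_mul, act_simple, ← hc] at hd
  have e : D.comb d = D.comb (-c + Pi.single i (D.comb c (D.h i))) := by
    rw [hd, comb_add, comb_neg, comb_single]
    module
  have e := D.comb_injective e
  -- The non-negative root `u α_j` becomes non-positive under `σ_i`, which alters only the
  -- coefficient of `α_i`; all other coefficients therefore vanish.
  have hci : c = Pi.single i (c i) := by
    funext k
    by_cases hk : k = i
    · subst hk
      simp
    · have h3 := congrFun e k
      simp only [Pi.add_apply, Pi.neg_apply, Pi.single_eq_of_ne hk] at h3 ⊢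
      have h4 := c0 k
      have h5 := d0 k
      omega
  -- Applying `u⁻¹` gives `c_i (u⁻¹ α_i) = α_j`, and the coefficient at `j` shows that `c_i ≥ 0`
  -- divides `1`.
  obtain ⟨b, hb⟩ := D.exists_comb_eq_root u⁻¹ i
  rw [hci, comb_single] at hc
  have h6 := congrArg (D.act u⁻¹) hc
  rw [act_zsmul, act_inv_act, ← hb, ← comb_smul, ← one_smul ℤ (D.α j), ← comb_single] at h6
  have h7 := congrFun (D.comb_injective h6) j
  simp only [Pi.smul_apply, smul_eq_mul, Pi.single_eq_same] at h7
  have h8 : c i = 1 := Int.eq_one_of_mul_eq_one_right (c0 i) h7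
  rw [← hc, h8, one_smul]

/-! ### Roots of parabolic subgroups and signs of roots -/

variable {D} in
theorem subRoots_nonneg_or {J : Set ι} {β : Module.Dual ℤ H} (h : β ∈ D.subRoots J) :
    D.NonnegOn J β ∨ D.NonnegOn J (-β) := by
  obtain ⟨v, hv, j, hj, rfl⟩ := h
  exact D.parabolic_nonneg_or_nonneg_neg hv hj

theorem subRoots_mono {J K : Set ι} (h : J ⊆ K) : D.subRoots J ⊆ D.subRoots K := by
  rintro β ⟨v, hv, j, hj, rfl⟩
  exact ⟨v, A.parabolic_mono h hv, j, h hj, rfl⟩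

theorem act_mem_subRoots {J : Set ι} {v : A.Weyl} (hv : v ∈ A.parabolic J) {j : ι} (hj : j ∈ J) :
    D.act v (D.α j) ∈ D.subRoots J := ⟨v, hv, j, hj, rfl⟩

theorem disjoint_subRoots {J K : Set ι} (hJK : Disjoint J K) :
    Disjoint (D.subRoots J) (D.subRoots K) := by
  rw [Set.disjoint_left]
  intro β hJ hK
  have h1 : D.SpanOn J β := (subRoots_nonneg_or hJ).elim (·.spanOn)
    fun h => by simpa using h.spanOn.neg
  have h2 : D.SpanOn K β := (subRoots_nonneg_or hK).elim (·.spanOn)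
    fun h => by simpa using h.spanOn.neg
  obtain ⟨c, c1, c2⟩ := h1
  obtain ⟨d, d1, d2⟩ := h2
  have hcd : c = d := D.comb_injective (c2.trans d2.symm)
  have h0 : c = 0 := by
    funext k
    by_cases hk : k ∈ J
    · rw [hcd, d1 k (Set.disjoint_left.1 hJK hk), Pi.zero_apply]
    · rw [c1 k hk, Pi.zero_apply]
  obtain ⟨v, -, j, -, h⟩ := hJ
  rw [h0, comb_zero, h] at c2
  exact D.root_ne_zero v j c2.symm

/-- Otherwise `α_i = u β'` for a root `β'` of `W_J`. Minimality of `u` forbids a negative `β'`, and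
minimality of `σ_i u` a positive one, since `σ_i u β' = -α_i`. -/
theorem notMem_subRoots {J : Set ι} {u v : A.Weyl} (hu : u ∈ A.minRight J) {i : ι}
    (hiu : A.σ i * u ∈ A.minRight J) (hv : v ∈ A.parabolic J) :
    D.act v (D.act u⁻¹ (D.α i)) ∉ D.subRoots J := by
  rintro ⟨v', hv', j, hj, h⟩
  have h0 : D.act u (D.act (v⁻¹ * v') (D.α j)) = D.α i := by
    rw [act_mul, ← h, act_inv_act, act_act_inv]
  have h1 : D.act (A.σ i * u) (D.act (v⁻¹ * v') (D.α j)) = -D.α i := by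
    rw [act_mul, h0, act_simple_root_self]
  have hi : D.α i ≠ 0 := D.indep_α.ne_zero i
  have hpos := D.nonnegOn_simple (mem_univ i)
  rcases D.parabolic_nonneg_or_nonneg_neg (mul_mem (inv_mem hv) hv') hj with h2 | h2
  · have h3 := D.act_nonneg_of_forall_not_isRightDescent (D.mem_minRight_iff.1 hiu) h2
    rw [h1] at h3
    exact hi (hpos.eq_zero h3)
  · have h3 := D.act_nonneg_of_forall_not_isRightDescent (D.mem_minRight_iff.1 hu) h2
    rw [act_neg, h0] at h3
    exact hi (hpos.eq_zero h3)

theorem mem_posRoots_iff (w : A.Weyl) (i : ι) :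
    D.act w (D.α i) ∈ D.posRoots ↔ A.cs.length (w * A.σ i) = A.cs.length w + 1 := by
  rw [← A.cs.not_isRightDescent_iff, ← D.nonneg_iff, ← mem_Qpos_iff]
  exact ⟨fun h => h.2.1, fun h => ⟨⟨w, i, rfl⟩, h, D.root_ne_zero w i⟩⟩

theorem mem_negRoots_iff (w : A.Weyl) (i : ι) :
    D.act w (D.α i) ∈ D.negRoots ↔ A.cs.length (w * A.σ i) + 1 = A.cs.length w := by
  rw [← A.cs.isRightDescent_iff, ← D.nonneg_neg_iff, ← mem_Qpos_iff]
  exact ⟨fun h => h.2.1, fun h => ⟨⟨w, i, rfl⟩, h, D.root_ne_zero w i⟩⟩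

end Realization

/-! ### Indecomposable symmetrizable generalized Cartan matrices of non-finite type -/

section FiniteType

open Matrix

variable {κ : Type*} [Fintype κ] [DecidableEq κ]

/-- A real matrix with diagonal entries `2`, non-positive off-diagonal entries, symmetrized by the
positive diagonal matrix `diagonal d`, and indecomposable. -/
structure IsIndecomposableCartan (N : Matrix κ κ ℝ) (d : κ → ℝ) : Prop where
  diag : ∀ i, N i i = 2
  off_diag : ∀ i j, i ≠ j → N i j ≤ 0
  pos : ∀ i, 0 < d i
  symm : ∀ i j, d i * N i j = d j * N j i
  indecomposable : ∀ S : Set κ, S.Nonempty → S ≠ univ → ∃ i ∈ S, ∃ j ∉ S, N i j ≠ 0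

namespace IsIndecomposableCartan

variable {N : Matrix κ κ ℝ} {d : κ → ℝ} (hN : IsIndecomposableCartan N d)

include hN

/-- Indecomposability joins some `j` outside the support of `v` to an index inside it; in row `j`
all summands are non-positive and one is negative. -/
theorem exists_mulVec_neg {v : κ → ℝ} (hv : ∀ k, 0 ≤ v k) (hv0 : v ≠ 0) (hv1 : ¬ ∀ k, 0 < v k) :
    ∃ j, v j = 0 ∧ (N *ᵥ v) j < 0 := by
  obtain ⟨i, hi, j, hj, hij⟩ := hN.indecomposable {k | 0 < v k}
    (by
      obtain ⟨k, hk⟩ := Function.ne_iff.1 hv0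
      exact ⟨k, lt_of_le_of_ne (hv k) (Ne.symm hk)⟩)
    (by
      intro h
      exact hv1 fun k => (h ▸ mem_univ k : k ∈ {k | 0 < v k}))
  have hi : 0 < v i := hi
  have hj : v j = 0 := le_antisymm (not_lt.1 hj) (hv j)
  have hne : j ≠ i := by
    rintro rfl
    exact hi.ne' hj
  have hji : N j i < 0 := by
    refine lt_of_le_of_ne (hN.off_diag j i hne) fun h => hij ?_
    have h1 := hN.symm i j
    rw [h, mul_zero] at h1
    exact (mul_eq_zero.1 h1).resolve_left (hN.pos i).ne'
  refine ⟨j, hj, Finset.sum_neg' (fun m _ => ?_) ⟨i, Finset.mem_univ i, mul_neg_of_neg_of_pos hji hi⟩⟩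
  by_cases hm : j = m
  · rw [← hm, hj, mul_zero]
  · exact mul_nonpos_of_nonpos_of_nonneg (hN.off_diag j m hm) (hv m)

theorem exists_pos_of_nonneg {v : κ → ℝ} (hv : ∀ k, 0 ≤ v k) (hv0 : v ≠ 0)
    (hNv : ∀ k, (N *ᵥ v) k ≤ 0) : ∃ u : κ → ℝ, (∀ k, 0 < u k) ∧ ∀ k, (N *ᵥ u) k ≤ 0 := by
  induction hn : (Finset.univ.filter fun k => v k = 0).card using Nat.strong_induction_on
    generalizing v with
  | _ n ih =>
  subst hn
  by_cases hv1 : ∀ k, 0 < v k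
  · exact ⟨v, hv1, hNv⟩
  obtain ⟨j, hj, hneg⟩ := hN.exists_mulVec_neg hv hv0 hv1
  -- The largest increase at `j` that keeps row `j` non-positive: the diagonal entry is `2`, so the
  -- new value is `0`. Each such step enlarges the support.
  set δ := -(N *ᵥ v) j / 2 with hδ
  have hδ0 : 0 < δ := by
    rw [hδ]
    linarith
  have hsingle : ∀ k, 0 ≤ (Pi.single j δ : κ → ℝ) k := fun k =>
    (Pi.single_nonneg (α := fun _ : κ => ℝ) (i := j)).2 hδ0.le k
  refine ih _ ?_ (v := v + Pi.single j δ) (fun k => add_nonneg (hv k) (hsingle k)) ?_ ?_ rfl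
  · refine Finset.card_lt_card (Finset.ssubset_iff_of_subset ?_ |>.2 ⟨j, by simp [hj], ?_⟩)
    · intro k hk
      simp only [Finset.mem_filter, Finset.mem_univ, true_and, Pi.add_apply] at hk ⊢
      linarith [hv k, hsingle k]
    · simp [hj, hδ0.ne']
  · intro h
    have := congrFun h j
    simp [hj, hδ0.ne'] at this
  · intro k
    rw [mulVec_add, Pi.add_apply, mulVec_single]
    simp only [Pi.smul_apply, MulOpposite.smul_eq_mul_unop, MulOpposite.unop_op, col_apply]
    by_cases hk : k = j
    · subst hk
      rw [hN.diag, hδ]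
      linarith
    · have := hN.off_diag k j hk
      nlinarith [hNv k]

theorem dotProduct_mulVec_comm (v w : κ → ℝ) :
    v ⬝ᵥ ((diagonal d * N) *ᵥ w) = w ⬝ᵥ ((diagonal d * N) *ᵥ v) := by
  have hT : (diagonal d * N)ᵀ = diagonal d * N := by
    ext i j
    rw [transpose_apply, diagonal_mul, diagonal_mul]
    exact hN.symm j i
  rw [dotProduct_mulVec, ← mulVec_transpose, hT, dotProduct_comm]

omit hN in
theorem diagonal_mul_mulVec (v : κ → ℝ) (k : κ) :
    ((diagonal d * N) *ᵥ v) k = d k * (N *ᵥ v) k := by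
  rw [← mulVec_mulVec, mulVec_diagonal]

/-- A minimizer `u` of the quadratic form on the standard simplex works. If `(N u)_i > 0`, then `u_i
> 0`, and moving `u` away from the vertex `i` stays in the simplex and lowers the form, because the
minimum is at most `0`. -/
theorem exists_nonneg_of_le_zero {v : κ → ℝ} (hv : ∀ k, 0 ≤ v k) (hv0 : v ≠ 0)
    (hq : v ⬝ᵥ ((diagonal d * N) *ᵥ v) ≤ 0) :
    ∃ u : κ → ℝ, (∀ k, 0 ≤ u k) ∧ u ≠ 0 ∧ ∀ k, (N *ᵥ u) k ≤ 0 := by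
  set B := diagonal d * N with hB
  have hcont : Continuous fun w : κ → ℝ => w ⬝ᵥ (B *ᵥ w) := by
    unfold dotProduct mulVec dotProduct
    fun_prop
  have hsum : 0 < ∑ k, v k := by
    obtain ⟨k, hk⟩ := Function.ne_iff.1 hv0
    exact Finset.sum_pos' (fun k _ => hv k)
      ⟨k, Finset.mem_univ k, lt_of_le_of_ne (hv k) (Ne.symm hk)⟩
  have hmem : (∑ k, v k)⁻¹ • v ∈ stdSimplex ℝ κ := by
    refine ⟨fun k => mul_nonneg (inv_nonneg.2 hsum.le) (hv k), ?_⟩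
    simp only [Pi.smul_apply, smul_eq_mul, ← Finset.mul_sum]
    exact inv_mul_cancel₀ hsum.ne'
  obtain ⟨u, hu, hmin⟩ := (isCompact_stdSimplex ℝ κ).exists_isMinOn ⟨_, hmem⟩ hcont.continuousOn
  have hmin : ∀ w ∈ stdSimplex ℝ κ, u ⬝ᵥ (B *ᵥ u) ≤ w ⬝ᵥ (B *ᵥ w) := fun w hw => hmin hw
  have hq0 : u ⬝ᵥ (B *ᵥ u) ≤ 0 := by
    refine (hmin _ hmem).trans ?_
    rw [mulVec_smul, dotProduct_smul, smul_dotProduct, smul_eq_mul, smul_eq_mul, ← mul_assoc]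
    exact mul_nonpos_of_nonneg_of_nonpos (by positivity) hq
  refine ⟨u, hu.1, ?_, fun i => ?_⟩
  · rintro rfl
    have := hu.2
    simp at this
  by_contra! hi
  rcases (hu.1 i).eq_or_lt with h0 | h0
  · refine absurd hi (not_lt.2 (Finset.sum_nonpos fun m _ => ?_))
    by_cases hm : i = m
    · rw [← hm, ← h0, mul_zero]
    · exact mul_nonpos_of_nonpos_of_nonneg (hN.off_diag i m hm) (hu.1 m)
  · have hb : 0 < (B *ᵥ u) i := by
      rw [hB, diagonal_mul_mulVec]
      exact mul_pos (hN.pos i) hi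
    have hBi : B i i = 2 * d i := by rw [hB, diagonal_mul, hN.diag, mul_comm]
    have hBi0 : 0 < B i i := by
      rw [hBi]
      linarith [hN.pos i]
    -- The bound `u_i` keeps `(1 + t) u - t e_i` in the simplex; the other one prevents the term `t²
    -- B_ii` from offsetting the linear decrease.
    set t := min (u i) ((B *ᵥ u) i / B i i) with ht
    have ht0 : 0 < t := lt_min h0 (div_pos hb hBi0)
    have ht1 : t ≤ u i := min_le_left _ _
    have ht2 : t * B i i ≤ (B *ᵥ u) i := by
      rw [← le_div_iff₀ hBi0]
      exact min_le_right _ _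
    have hw : (1 + t) • u - t • Pi.single i (1 : ℝ) ∈ stdSimplex ℝ κ := by
      refine ⟨fun k => ?_, ?_⟩
      · simp only [Pi.sub_apply, Pi.smul_apply, smul_eq_mul]
        by_cases hk : k = i
        · subst hk
          rw [Pi.single_eq_same]
          nlinarith
        · rw [Pi.single_eq_of_ne hk]
          have := hu.1 k
          nlinarith
      · simp only [Pi.sub_apply, Pi.smul_apply, smul_eq_mul, Finset.sum_sub_distrib,
          ← Finset.mul_sum, hu.2, Finset.sum_pi_single', Finset.mem_univ, if_true]
        ring
    have h1 := hmin _ hw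
    have h2 : u ⬝ᵥ (B *ᵥ Pi.single i (1 : ℝ)) = (B *ᵥ u) i := by
      rw [hB, hN.dotProduct_mulVec_comm, single_one_dotProduct]
    have h3 : (Pi.single i (1 : ℝ)) ⬝ᵥ (B *ᵥ Pi.single i (1 : ℝ)) = B i i := by
      rw [single_one_dotProduct, mulVec_single_one, col_apply]
    have h4 : (Pi.single i (1 : ℝ)) ⬝ᵥ (B *ᵥ u) = (B *ᵥ u) i := single_one_dotProduct _ _
    simp only [mulVec_sub, mulVec_smul, dotProduct_sub, sub_dotProduct, dotProduct_smul,
      smul_dotProduct, smul_eq_mul, h2, h3, h4] at h1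
    set q := u ⬝ᵥ (B *ᵥ u)
    set b := (B *ᵥ u) i
    have h5 : 0 ≤ t * ((2 + t) * q - 2 * (1 + t) * b + t * B i i) := by linarith
    have h6 : 0 ≤ (2 + t) * q - 2 * (1 + t) * b + t * B i i := nonneg_of_mul_nonneg_right h5 ht0
    nlinarith

/-- Let `B = diagonal d * N`. Then `v⁻ · B v ≥ 0`, while `v⁻ · B v⁺ ≤ 0` because `v⁺` and `v⁻` have
disjoint supports. So `v⁻ · B v⁻ ≤ 0`, which forces `v⁻ = 0`; indecomposability then excludes
isolated zeros of a nonzero `v`. -/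
theorem pos_or_eq_zero (hq : ∀ v : κ → ℝ, (∀ k, 0 ≤ v k) → v ≠ 0 →
    0 < v ⬝ᵥ ((diagonal d * N) *ᵥ v)) {v : κ → ℝ} (hv : ∀ k, 0 ≤ (N *ᵥ v) k) :
    (∀ k, 0 < v k) ∨ v = 0 := by
  have hdec : v = v⁺ - v⁻ := (posPart_sub_negPart v).symm
  have hneg : v⁻ = 0 := by
    by_contra hne
    have h1 := hq v⁻ (fun k => negPart_nonneg v k) hne
    have h2 : 0 ≤ v⁻ ⬝ᵥ ((diagonal d * N) *ᵥ v) := by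
      refine Finset.sum_nonneg fun k _ => mul_nonneg (negPart_nonneg v k) ?_
      rw [diagonal_mul_mulVec]
      exact mul_nonneg (hN.pos k).le (hv k)
    have h3 : v⁻ ⬝ᵥ ((diagonal d * N) *ᵥ v⁺) ≤ 0 := by
      refine Finset.sum_nonpos fun k _ => ?_
      rw [mulVec, dotProduct, Finset.mul_sum]
      refine Finset.sum_nonpos fun m _ => ?_
      rw [diagonal_mul]
      have hkn : 0 ≤ v⁻ k := negPart_nonneg v k
      have hmp : 0 ≤ v⁺ m := posPart_nonneg v m
      by_cases hkm : k = m
      · subst hkm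
        have : v⁻ k * v⁺ k = 0 := by
          rw [Pi.negPart_apply, Pi.posPart_apply]
          rcases le_total 0 (v k) with h | h
          · rw [negPart_eq_zero.2 h, zero_mul]
          · rw [posPart_eq_zero.2 h, mul_zero]
        rw [mul_left_comm, this, mul_zero]
      · have h5 := mul_nonneg (mul_nonneg hkn hmp) (hN.pos k).le
        have h6 := hN.off_diag k m hkm
        nlinarith
    conv at h2 =>
      rw [hdec]
    rw [mulVec_sub, dotProduct_sub] at h2
    simp only [← hdec] at h2
    linarith
  have hpos : ∀ k, 0 ≤ v k := by
    intro k
    rw [hdec, hneg, sub_zero]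
    exact posPart_nonneg v k
  by_contra! hcon
  obtain ⟨j, -, hj⟩ := hN.exists_mulVec_neg hpos hcon.2 (by
    push Not
    exact hcon.1)
  exact absurd (hv j) (not_le.2 hj)

/-- Dichotomy on the quadratic form. If it is positive on nonzero non-negative vectors, all three
conditions of finite type follow from `pos_or_eq_zero`. Otherwise minimization gives a non-negative
solution, whose support is then enlarged to all indices. -/
theorem exists_pos_mulVec_nonpos [Nonempty κ] {M : Matrix κ κ ℤ}
    (hM : N = M.map (fun z : ℤ => (z : ℝ))) (hfin : ¬ IsFiniteType M) :
    ∃ u : κ → ℝ, (∀ k, 0 < u k) ∧ ∀ k, (N *ᵥ u) k ≤ 0 := by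
  by_cases hq : ∀ v : κ → ℝ, (∀ k, 0 ≤ v k) → v ≠ 0 → 0 < v ⬝ᵥ ((diagonal d * N) *ᵥ v)
  · exfalso
    have key := fun v => hN.pos_or_eq_zero hq (v := v)
    have hdet : N.det ≠ 0 := by
      intro h
      obtain ⟨v, hv0, hv⟩ := exists_mulVec_eq_zero_iff.2 h
      obtain ⟨k⟩ := ‹Nonempty κ›
      have h1 := (key v (fun k => by rw [hv]; rfl)).resolve_right hv0 k
      have h2 := (key (-v) (fun k => by rw [mulVec_neg, hv, neg_zero]; rfl)).resolve_right
        (neg_ne_zero.2 hv0) k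
      simp only [Pi.neg_apply] at h2
      linarith
    have hsum : ∀ (v : κ → ℝ) k, ∑ m, (M k m : ℝ) * v m = (N *ᵥ v) k := by
      intro v k
      rw [hM]
      rfl
    refine hfin ⟨?_, ?_, ?_⟩
    · intro h
      apply hdet
      have h1 := (Int.castRingHom ℝ).map_det M
      rw [h, map_zero] at h1
      rw [hM]
      exact h1.symm
    · have hu : N *ᵥ (N⁻¹ *ᵥ 1) = 1 := by
        rw [mulVec_mulVec, mul_nonsing_inv _ (isUnit_iff_ne_zero.2 hdet), one_mulVec]
      refine ⟨N⁻¹ *ᵥ 1, ?_, fun k => ?_⟩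
      · refine (key (N⁻¹ *ᵥ 1) fun k => ?_).resolve_right ?_
        · rw [hu]
          exact zero_le_one
        · intro h
          rw [h, mulVec_zero] at hu
          obtain ⟨k⟩ := ‹Nonempty κ›
          exact zero_ne_one (congrFun hu k)
      · rw [hsum, hu]
        exact zero_lt_one
    · intro v hv
      exact key v fun k => by
        rw [← hsum]
        exact hv k
  · push Not at hq
    obtain ⟨v, hv, hv0, hle⟩ := hq
    obtain ⟨u, hu, hu0, hNu⟩ := hN.exists_nonneg_of_le_zero hv hv0 hle
    exact hN.exists_pos_of_nonneg hu hu0 hNu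

end IsIndecomposableCartan

end FiniteType

/-! ### Antidominant combinations of coroots supported on a special set -/

namespace SymmGCM

variable {ι : Type*} [Fintype ι] [DecidableEq ι] (A : SymmGCM ι)

theorem exists_symmetrizer : ∃ d : ι → ℝ, (∀ i, 0 < d i) ∧
    ∀ i j, d i * (A.a i j : ℝ) = d j * (A.a j i : ℝ) := by
  obtain ⟨ε, B, hε, hB, h⟩ := A.symmetrizable
  have hentry : ∀ i j, (A.a i j : ℝ) = (ε i : ℝ) * (B i j : ℝ) := by
    intro i j
    have := congrFun (congrFun h i) j
    rw [Matrix.map_apply, Matrix.diagonal_mul] at this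
    exact_mod_cast this
  have hε' : ∀ i, (0 : ℝ) < ε i := fun i => by exact_mod_cast hε i
  refine ⟨fun i => (ε i : ℝ)⁻¹, fun i => inv_pos.2 (hε' i), fun i j => ?_⟩
  rw [hentry, hentry, inv_mul_cancel_left₀ (hε' i).ne', inv_mul_cancel_left₀ (hε' j).ne',
    hB.apply]

open Classical in
/-- For special `Θ` there is an antidominant non-negative combination of coroots with
support `Θ`. -/
theorem exists_antidominant {Θ : Set ι} (hΘ : A.IsSpecial Θ) :
    ∃ c : ι → ℝ, (∀ i, 0 ≤ c i) ∧ (∀ i, 0 < c i ↔ i ∈ Θ) ∧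
      ∀ j, ∑ i, c i * (A.a i j : ℝ) ≤ 0 := by
  obtain ⟨d, hd, hsymm⟩ := A.exists_symmetrizer
  -- One vector for each `t ∈ Θ`, supported on the component of `t`; the sum over `t` has support
  -- exactly `Θ`.
  have key : ∀ t : Θ, ∃ c : ι → ℝ, (∀ i, 0 ≤ c i) ∧ 0 < c t ∧ (∀ i ∉ Θ, c i = 0) ∧
      ∀ j, ∑ i, c i * (A.a i j : ℝ) ≤ 0 := by
    intro t
    set C := (A.graph.induce Θ).connectedComponentMk t with hC
    have ht : t ∈ C.supp := rfl
    have : Nonempty C.supp := ⟨⟨t, ht⟩⟩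
    let M : Matrix C.supp C.supp ℤ :=
      A.a.submatrix (fun k : C.supp => ((k : Θ) : ι)) (fun k : C.supp => ((k : Θ) : ι))
    have hN : IsIndecomposableCartan (M.map (fun z : ℤ => (z : ℝ)))
        (fun k : C.supp => d ((k : Θ) : ι)) := by
      refine ⟨fun i => ?_, fun i j hij => ?_, fun i => hd _, fun i j => hsymm _ _, ?_⟩
      · simp [M, A.diag]
      · have := A.off_diag ((i : Θ) : ι) ((j : Θ) : ι)
          (fun h => hij (Subtype.ext (Subtype.ext h)))
        simp only [M, Matrix.map_apply, Matrix.submatrix_apply]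
        exact_mod_cast this
      · intro S ⟨x, hx⟩ hS
        obtain ⟨y, hy⟩ := (Set.ne_univ_iff_exists_notMem S).1 hS
        have hreach : (A.graph.induce Θ).Reachable x y :=
          SimpleGraph.ConnectedComponent.exact (x.2.trans y.2.symm)
        obtain ⟨p⟩ := hreach
        obtain ⟨e, -, he1, he2⟩ := p.exists_boundary_dart (Subtype.val '' S)
          (mem_image_of_mem _ hx) (fun ⟨z, hz, hzy⟩ => hy (Subtype.ext hzy ▸ hz))
        obtain ⟨z, hz, hze⟩ := he1
        have hsnd : e.snd ∈ C.supp :=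
          (C.mem_supp_congr_adj e.adj).1 (hze ▸ z.2)
        refine ⟨z, hz, ⟨e.snd, hsnd⟩, fun h => he2 ⟨_, h, rfl⟩, ?_⟩
        have hadj : A.a (e.fst : ι) (e.snd : ι) ≠ 0 := (e.adj : A.graph.Adj _ _).2
        simp only [M, Matrix.map_apply, Matrix.submatrix_apply, hze]
        exact_mod_cast hadj
    obtain ⟨u, hu, hNu⟩ := hN.exists_pos_mulVec_nonpos rfl (hΘ C)
    let g : C.supp → ι := fun k => ((k : Θ) : ι)
    have hg : Function.Injective g := fun a b h => Subtype.ext (Subtype.ext h)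
    -- The weights `d` turn rows into columns: as `d_m a_mk = d_k a_km`, the column sums of `c` on
    -- the component are `d_k (N u)_k`.
    let c : ι → ℝ := Function.extend g (fun k => d (g k) * u k) 0
    have hcg : ∀ k, c (g k) = d (g k) * u k := fun k => hg.extend_apply _ _ k
    have hc0 : ∀ i, i ∉ range g → c i = 0 := fun i hi =>
      Function.extend_apply' _ _ i (fun ⟨k, hk⟩ => hi ⟨k, hk⟩)
    have hcnn : ∀ i, 0 ≤ c i := by
      intro i
      by_cases hi : i ∈ range g
      · obtain ⟨k, rfl⟩ := hi
        rw [hcg]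
        exact mul_nonneg (hd _).le (hu k).le
      · rw [hc0 i hi]
    refine ⟨c, hcnn, ?_, ?_, fun j => ?_⟩
    · have := hcg ⟨t, ht⟩
      change c (t : ι) = _ at this
      rw [this]
      exact mul_pos (hd _) (hu _)
    · intro i hi
      refine hc0 i ?_
      rintro ⟨k, rfl⟩
      exact hi k.1.2
    · by_cases hj : j ∈ range g
      · obtain ⟨k, rfl⟩ := hj
        have hs : ∑ i, c i * (A.a i (g k) : ℝ) = ∑ m, c (g m) * (A.a (g m) (g k) : ℝ) := by
          refine (Finset.sum_of_injOn g hg.injOn (fun _ _ => Finset.mem_coe.2 (Finset.mem_univ _))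
            (fun i _ hi => ?_) (fun m _ => rfl)).symm
          rw [hc0 i (fun ⟨m, hm⟩ => hi ⟨m, Finset.mem_coe.2 (Finset.mem_univ m), hm⟩), zero_mul]
        rw [hs]
        have h1 : ∑ m, c (g m) * (A.a (g m) (g k) : ℝ) =
            d (g k) * (M.map (fun z : ℤ => (z : ℝ))).mulVec u k := by
          rw [Matrix.mulVec, dotProduct, Finset.mul_sum]
          refine Finset.sum_congr rfl fun m _ => ?_
          rw [hcg, mul_right_comm, hsymm, mul_assoc]
          rfl
        rw [h1]
        exact mul_nonpos_of_nonneg_of_nonpos (hd _).le (hNu k)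
      · refine Finset.sum_nonpos fun i _ => ?_
        by_cases hij : i = j
        · rw [hij, hc0 j hj, zero_mul]
        · exact mul_nonpos_of_nonneg_of_nonpos (hcnn i) (by exact_mod_cast A.off_diag i j hij)
  choose c c0 c1 c2 c3 using key
  refine ⟨∑ t, c t, fun i => ?_, fun i => ⟨fun hi => ?_, fun hi => ?_⟩, fun j => ?_⟩
  · rw [Finset.sum_apply]
    exact Finset.sum_nonneg fun t _ => c0 t i
  · by_contra h
    rw [Finset.sum_apply, Finset.sum_eq_zero fun t _ => c2 t i h] at hi
    exact lt_irrefl _ hi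
  · rw [Finset.sum_apply]
    exact Finset.sum_pos' (fun t _ => c0 t i) ⟨⟨i, hi⟩, Finset.mem_univ _, c1 ⟨i, hi⟩⟩
  · simp only [Finset.sum_apply, Finset.sum_mul]
    rw [Finset.sum_comm]
    exact Finset.sum_nonpos fun t _ => c3 t j

end SymmGCM

namespace Realization

variable {ι : Type*} [Fintype ι] [DecidableEq ι] {A : SymmGCM ι}
  {H : Type*} [AddCommGroup H] [Module.Free ℤ H] [Module.Finite ℤ H] (D : Realization A H)

/-! ### Stabilizers of dominant points -/

/-- An element of `Hom(H, ℤ)` viewed in `Hom(H, ℝ)`. -/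
def toReal (β : Module.Dual ℤ H) : H →ₗ[ℤ] ℝ := (Int.castAddHom ℝ).toIntLinearMap ∘ₗ β

omit [Module.Free ℤ H] [Module.Finite ℤ H] in
theorem toReal_apply (β : Module.Dual ℤ H) (x : H) : toReal β x = (β x : ℝ) := rfl

theorem act_toReal (w : A.Weyl) (β : Module.Dual ℤ H) :
    D.act w (toReal β) = toReal (D.act w β) := rfl

theorem toReal_comb (c : ι → ℤ) : toReal (D.comb c) = ∑ k, (c k : ℝ) • toReal (D.α k) := by
  ext x
  simp only [toReal_apply, comb, LinearMap.sum_apply, LinearMap.smul_apply, smul_eq_mul]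
  push_cast
  rfl

theorem act_simple_real (i : ι) (l : H →ₗ[ℤ] ℝ) :
    D.act (A.σ i) l = l - l (D.h i) • toReal (D.α i) := by
  ext x
  rw [act_simple_apply, LinearMap.sub_apply, LinearMap.smul_apply, smul_eq_mul, zsmul_eq_mul,
    mul_comm]
  rfl

/-- There is a linear functional on `𝐡*_ℝ` which takes the value `1` at all simple roots. -/
theorem exists_height : ∃ φ : (H →ₗ[ℤ] ℝ) →ₗ[ℝ] ℝ, ∀ i, φ (toReal (D.α i)) = 1 := by
  let b := Module.Free.chooseBasis ℤ H
  -- In coordinates, independence over `ℤ` passes to `ℝ`, so values on the simple roots can be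
  -- prescribed.
  have h1 : LinearIndependent ℤ fun i j => D.α i (b j) :=
    D.indep_α.map' (b.constr ℤ (M' := ℤ)).symm.toLinearMap (LinearEquiv.ker _)
  have h2 := linearIndependent_algebraMap_comp_iff (S := ℝ) |>.2 h1
  obtain ⟨ψ, hψ⟩ := LinearMap.exists_extend
    ((Module.Basis.span h2).constr ℝ (fun _ => (1 : ℝ)))
  let ev : (H →ₗ[ℤ] ℝ) →ₗ[ℝ] (Module.Free.ChooseBasisIndex ℤ H → ℝ) :=
    { toFun := fun l j => l (b j)
      map_add' := fun _ _ => rfl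
      map_smul' := fun _ _ => rfl }
  refine ⟨ψ ∘ₗ ev, fun i => ?_⟩
  have h3 := LinearMap.congr_fun hψ (Module.Basis.span h2 i)
  rw [Module.Basis.constr_basis, LinearMap.comp_apply, Submodule.subtype_apply,
    Module.Basis.span_apply] at h3
  exact h3

theorem height_pos {φ : (H →ₗ[ℤ] ℝ) →ₗ[ℝ] ℝ} (hφ : ∀ i, φ (toReal (D.α i)) = 1)
    {β : Module.Dual ℤ H} (hb : D.NonnegOn univ β) (h0 : β ≠ 0) : 0 < φ (toReal β) := by
  obtain ⟨c, c0, -, rfl⟩ := hb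
  rw [toReal_comb, map_sum]
  simp only [map_smul, hφ, smul_eq_mul, mul_one]
  have hc : c ≠ 0 := by
    rintro rfl
    exact h0 D.comb_zero
  obtain ⟨k, hk⟩ := Function.ne_iff.1 hc
  have hk' : 0 < c k := lt_of_le_of_ne (c0 k) (Ne.symm hk)
  exact Finset.sum_pos' (fun k _ => by exact_mod_cast c0 k)
    ⟨k, Finset.mem_univ k, by exact_mod_cast hk'⟩

/-- Splitting off a right descent `j`, `w l` is `(w σ_j) l` minus `l(h_j) ≥ 0` times the positive
root `(w σ_j) α_j`. No height is lost only if every letter split off satisfies `l(h_j) = 0`. -/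
theorem height_act_le {φ : (H →ₗ[ℤ] ℝ) →ₗ[ℝ] ℝ} (hφ : ∀ i, φ (toReal (D.α i)) = 1)
    {l : H →ₗ[ℤ] ℝ} (hl : l ∈ D.chamber) (w : A.Weyl) :
    φ (D.act w l) ≤ φ l ∧
      (φ (D.act w l) = φ l → w ∈ A.parabolic {i | l (D.h i) = 0}) := by
  induction hN : A.cs.length w using Nat.strong_induction_on generalizing w with
  | _ N ih =>
  subst hN
  by_cases hw : w = 1
  · rw [hw, act_one]
    exact ⟨le_rfl, fun _ => one_mem _⟩
  obtain ⟨j, hj⟩ := A.cs.exists_rightDescent_of_ne_one hw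
  have hw' : w * A.σ j * A.σ j = w := CoxeterSystem.simple_mul_simple_cancel_right A.cs j
  have h1 := ih _ hj (w * A.σ j) rfl
  have hpos := D.nonneg_of_not_isRightDescent (w * A.σ j) j
    (A.cs.isRightDescent_iff_not_isRightDescent_mul.1 hj)
  have hpos := D.height_pos hφ hpos (D.root_ne_zero _ j)
  have e : φ (D.act w l) = φ (D.act (w * A.σ j) l) -
      l (D.h j) * φ (toReal (D.act (w * A.σ j) (D.α j))) := by
    conv_lhs => rw [← hw', act_mul, act_simple_real, act_sub]
    have h2 : D.act (w * A.σ j) (l (D.h j) • toReal (D.α j)) =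
        l (D.h j) • toReal (D.act (w * A.σ j) (D.α j)) := rfl
    rw [map_sub, h2, map_smul, smul_eq_mul]
  have h2 := hl j
  have h3 := mul_nonneg h2 hpos.le
  refine ⟨by linarith [h1.1], fun heq => ?_⟩
  have h4 : l (D.h j) * φ (toReal (D.act (w * A.σ j) (D.α j))) = 0 := by linarith [h1.1]
  have h5 : l (D.h j) = 0 := (mul_eq_zero.1 h4).resolve_right hpos.ne'
  rw [← hw']
  exact mul_mem (h1.2 (by linarith)) (A.simple_mem_parabolic h5)

theorem mem_parabolic_of_act_eq {l : H →ₗ[ℤ] ℝ} (hl : l ∈ D.chamber) {w : A.Weyl}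
    (h : D.act w l = l) : w ∈ A.parabolic {i | l (D.h i) = 0} := by
  obtain ⟨φ, hφ⟩ := D.exists_height
  exact (D.height_act_le hφ hl w).2 (by rw [h])

/-- A dominant point whose stabilizer is generated by the simple reflections in `Θ`. -/
theorem exists_generic (Θ : Set ι) : ∃ l ∈ D.chamber, ∀ i, l (D.h i) = 0 ↔ i ∈ Θ := by
  classical
  obtain ⟨Λ, hΛ⟩ := D.exists_fundamental
  have h : ∀ i, (∑ k ∈ Finset.univ.filter (· ∉ Θ), toReal (Λ k)) (D.h i) =
      if i ∈ Θ then 0 else 1 := by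
    intro i
    simp only [LinearMap.sum_apply, toReal_apply, hΛ, Int.cast_ite, Int.cast_one, Int.cast_zero]
    rw [Finset.sum_ite_eq']
    by_cases hi : i ∈ Θ <;> simp [hi]
  refine ⟨∑ k ∈ Finset.univ.filter (· ∉ Θ), toReal (Λ k), fun i => ?_, fun i => ?_⟩
  · rw [h]
    split_ifs <;> norm_num
  · rw [h]
    split_ifs with hi <;> simp [hi]

theorem chamber_subset_tits : D.chamber ⊆ D.tits := fun l hl => ⟨1, l, hl, (D.act_one l).symm⟩

theorem act_eq_of_mem_parabolic {Θ : Set ι} {v : A.Weyl} (hv : v ∈ A.parabolic Θ)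
    {l : H →ₗ[ℤ] ℝ} (hl : ∀ i ∈ Θ, l (D.h i) = 0) : D.act v l = l := by
  induction hv using SymmGCM.parabolic_induction with
  | one => exact D.act_one l
  | mul v hv j hj ih => rw [act_mul, act_simple_real, hl j hj, zero_smul, sub_zero, ih]

/-- `Z_W(R(Θ)) = W_Θ`. -/
theorem pointStab_RSet (Θ : Set ι) : D.pointStab (D.RSet Θ) = A.parabolic Θ := by
  ext w
  constructor
  · intro hw
    obtain ⟨l, hl, hΘ⟩ := D.exists_generic Θ
    have h := D.mem_parabolic_of_act_eq hl
      (hw l ⟨D.chamber_subset_tits hl, fun i hi => (hΘ i).2 hi⟩)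
    simp only [hΘ] at h
    exact h
  · intro hw l hl
    exact D.act_eq_of_mem_parabolic hw hl.2

theorem act_perp_mem_RSet {Θ : Set ι} {v : A.Weyl} (hv : v ∈ A.parabolic (A.perp Θ))
    {l : H →ₗ[ℤ] ℝ} (hl : l ∈ D.RSet Θ) : D.act v l ∈ D.RSet Θ := by
  induction hv using SymmGCM.parabolic_induction generalizing l with
  | one => rwa [act_one]
  | mul v hv j hj ih =>
    rw [act_mul]
    refine ih ⟨D.act_mem_tits _ hl.1, fun i hi => ?_⟩
    rw [act_simple_apply, hl.2 i hi, D.pairing, (A.zero_iff i j).2 (hj i hi), zero_smul, sub_zero]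

theorem act_perp_image_RSet {Θ : Set ι} {v : A.Weyl} (hv : v ∈ A.parabolic (A.perp Θ)) :
    D.act v '' D.RSet Θ = D.RSet Θ := by
  refine Subset.antisymm ?_ fun l hl => ?_
  · rintro _ ⟨l, hl, rfl⟩
    exact D.act_perp_mem_RSet hv hl
  · exact ⟨_, D.act_perp_mem_RSet (inv_mem hv) hl, D.act_act_inv v l⟩

/-! ### The Weyl group orbit of an antidominant element -/

/-- The value of `l` at the element `∑ c_i h_i` of `H ⊗ ℝ`. -/
def evalComb (l : H →ₗ[ℤ] ℝ) (c : ι → ℝ) : ℝ := ∑ i, c i * l (D.h i)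

theorem evalComb_root_nonpos {c : ι → ℝ} (hc : ∀ j, ∑ i, c i * (A.a i j : ℝ) ≤ 0)
    {β : Module.Dual ℤ H} (hb : D.NonnegOn univ β) : D.evalComb (toReal β) c ≤ 0 := by
  obtain ⟨d, d0, -, rfl⟩ := hb
  have e : D.evalComb (toReal (D.comb d)) c = ∑ k, (d k : ℝ) * ∑ i, c i * (A.a i k : ℝ) := by
    simp only [evalComb, toReal_comb, LinearMap.sum_apply, LinearMap.smul_apply, toReal_apply,
      D.pairing, smul_eq_mul, Finset.mul_sum]
    rw [Finset.sum_comm]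
    exact Finset.sum_congr rfl fun k _ => Finset.sum_congr rfl fun i _ => by ring
  rw [e]
  exact Finset.sum_nonpos fun k _ =>
    mul_nonpos_of_nonneg_of_nonpos (by exact_mod_cast d0 k) (hc k)

theorem evalComb_act_simple (j : ι) (l : H →ₗ[ℤ] ℝ) (c : ι → ℝ) :
    D.evalComb (D.act (A.σ j) l) c =
      D.evalComb l (c - Pi.single j (∑ i, c i * (A.a i j : ℝ))) := by
  simp only [evalComb, act_simple_apply, D.pairing, Pi.sub_apply, sub_mul, mul_sub,
    Finset.sum_sub_distrib]
  congr 1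
  have h : ∑ k, (Pi.single j (∑ i, c i * (A.a i j : ℝ)) : ι → ℝ) k * l (D.h k) =
      (∑ i, c i * (A.a i j : ℝ)) * l (D.h j) := by
    rw [Finset.sum_eq_single j (fun k _ hk => by rw [Pi.single_eq_of_ne hk, zero_mul]) (by simp),
      Pi.single_eq_same]
  rw [h, Finset.sum_mul]
  exact Finset.sum_congr rfl fun i _ => by rw [zsmul_eq_mul, mul_assoc]

theorem rep_mul_apply (v w : A.Weyl) (x : H) : D.rep (v * w) x = D.rep v (D.rep w x) := by
  rw [map_mul, Module.End.mul_apply]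

theorem rep_simple_apply (j : ι) (x : H) : D.rep (A.σ j) x = x - D.α j x • D.h j := by
  have h : D.rep (A.σ j) = D.refl j := A.cs.lift_apply_simple D.refl_liftable j
  rw [h, refl_apply]

/-- If `y = ∑ c_i h_i` is antidominant with support `Θ`, then `w y` is a non-negative combination
of coroots, whose support contains `Θ`, spans `w h_i` for `i ∈ Θ`, and equals `Θ` only
for `w ∈ W_{Θ ∪ Θ^⊥}`. -/
theorem exists_orbit {Θ : Set ι} {c : ι → ℝ} (c0 : ∀ i, 0 ≤ c i) (cΘ : ∀ i, 0 < c i ↔ i ∈ Θ)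
    (hc : ∀ j, ∑ i, c i * (A.a i j : ℝ) ≤ 0) (w : A.Weyl) :
    ∃ d : ι → ℝ, (∀ i, 0 ≤ d i) ∧ (∀ i ∈ Θ, 0 < d i) ∧
      (∀ l, D.evalComb (D.act w⁻¹ l) c = D.evalComb l d) ∧
      (∀ i ∈ Θ, D.rep w (D.h i) ∈ Submodule.span ℤ (D.h '' {k | 0 < d k})) ∧
      ((∀ k, 0 < d k → k ∈ Θ) → w ∈ A.parabolic (Θ ∪ A.perp Θ)) := by
  induction hN : A.cs.length w using Nat.strong_induction_on generalizing w with
  | _ N ih =>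
  subst hN
  by_cases hw : w = 1
  · subst hw
    refine ⟨c, c0, fun i hi => (cΘ i).2 hi, fun l => by rw [inv_one, act_one], fun i hi => ?_,
      fun _ => one_mem _⟩
    rw [map_one, Module.End.one_apply]
    exact Submodule.subset_span (mem_image_of_mem _ ((cΘ i).2 hi))
  obtain ⟨j, hj⟩ := A.cs.exists_leftDescent_of_ne_one hw
  obtain ⟨v, rfl⟩ : ∃ v, w = A.σ j * v :=
    ⟨A.σ j * w, (A.cs.simple_mul_simple_cancel_left j).symm⟩
  have hjv : ¬ A.cs.IsRightDescent v⁻¹ j := by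
    rw [A.cs.isRightDescent_inv_iff]
    intro h
    have h1 := A.cs.isLeftDescent_iff_not_isLeftDescent_mul.1 h
    exact h1 hj
  obtain ⟨d, d0, dΘ, deval, dspan, dpar⟩ := ih (A.cs.length v)
    (A.cs.isLeftDescent_iff.1 hj ▸ by
      rw [CoxeterSystem.simple_mul_simple_cancel_left]
      omega) v rfl
  set m := ∑ i, d i * (A.a i j : ℝ) with hm
  -- `m` is the value of `α_j` at `v y`, that is, of the positive root `v⁻¹ α_j` at the antidominant
  -- `y`. Thus `σ_j` can only increase the coefficient at `j`.
  have hm0 : m ≤ 0 := by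
    have h1 := D.evalComb_root_nonpos hc (D.nonneg_of_not_isRightDescent v⁻¹ j hjv)
    rw [← act_toReal, deval] at h1
    simpa only [evalComb, toReal_apply, D.pairing] using h1
  have hle : ∀ k, d k ≤ (d - Pi.single j m : ι → ℝ) k := by
    intro k
    rw [Pi.sub_apply]
    by_cases hk : k = j
    · subst hk
      rw [Pi.single_eq_same]
      linarith
    · rw [Pi.single_eq_of_ne hk, sub_zero]
  refine ⟨d - Pi.single j m, fun k => (d0 k).trans (hle k),
    fun i hi => (dΘ i hi).trans_le (hle i), fun l => ?_, ?_, ?_⟩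
  · rw [mul_inv_rev, CoxeterSystem.inv_simple, act_mul, deval, evalComb_act_simple]
  · have hsub : Submodule.span ℤ (D.h '' {k | 0 < d k}) ≤
        Submodule.span ℤ (D.h '' {k | 0 < (d - Pi.single j m : ι → ℝ) k}) :=
      Submodule.span_mono (image_mono fun k hk => lt_of_lt_of_le hk (hle k))
    have hmap : ∀ x ∈ Submodule.span ℤ (D.h '' {k | 0 < d k}), D.rep (A.σ j) x ∈
        Submodule.span ℤ (D.h '' {k | 0 < (d - Pi.single j m : ι → ℝ) k}) := by
      intro x hx
      induction hx using Submodule.span_induction with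
      | zero => rw [map_zero]; exact zero_mem _
      | add x y _ _ h1 h2 => rw [map_add]; exact add_mem h1 h2
      | smul a x _ h1 => rw [map_smul]; exact Submodule.smul_mem _ a h1
      | mem x hx =>
        obtain ⟨k, hk, rfl⟩ := hx
        rw [rep_simple_apply, D.pairing]
        refine sub_mem (hsub (Submodule.subset_span (mem_image_of_mem _ hk))) ?_
        by_cases hj0 : 0 < (d - Pi.single j m : ι → ℝ) j
        · exact Submodule.smul_mem _ _ (Submodule.subset_span (mem_image_of_mem _ hj0))
        -- For `j` outside the new support, `d j = 0` and `m = 0`. The summands of `m` are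
        -- non-positive, so each vanishes and `σ_j` fixes `h_k`.
        · have hdj : d j = 0 := le_antisymm ((hle j).trans (not_lt.1 hj0)) (d0 j)
          have hm1 : m = 0 := by
            have h1 := not_lt.1 hj0
            rw [Pi.sub_apply, Pi.single_eq_same, hdj] at h1
            linarith
          have h2 := (Finset.sum_eq_zero_iff_of_nonpos fun i _ => by
            by_cases hij : i = j
            · rw [hij, hdj, zero_mul]
            · exact mul_nonpos_of_nonneg_of_nonpos (d0 i)
                (by exact_mod_cast A.off_diag i j hij)).1 (hm.symm.trans hm1) k
            (Finset.mem_univ k)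
          have h3 := (mul_eq_zero.1 h2).resolve_left (ne_of_gt hk)
          rw [Int.cast_eq_zero.1 h3, zero_smul]
          exact zero_mem _
    intro i hi
    rw [rep_mul_apply]
    exact hmap _ (dspan i hi)
  · intro hsupp
    have hsupp' : ∀ k, 0 < d k → k ∈ Θ := fun k hk => hsupp k (hk.trans_le (hle k))
    refine mul_mem (A.simple_mem_parabolic ?_) (dpar hsupp')
    by_cases hjΘ : j ∈ Θ
    · exact Or.inl hjΘ
    -- With `j ∉ Θ`, the support stays inside `Θ` only if `m = 0`, and then every summand of `m`
    -- vanishes, which makes `j` orthogonal to `Θ`.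
    · right
      have hdj : d j = 0 := le_antisymm (not_lt.1 fun h => hjΘ (hsupp' j h)) (d0 j)
      have hm1 : m = 0 := by
        have h1 := not_lt.1 fun h => hjΘ (hsupp j h)
        rw [Pi.sub_apply, Pi.single_eq_same, hdj] at h1
        linarith
      intro k hk
      have h2 := (Finset.sum_eq_zero_iff_of_nonpos fun i _ => by
        by_cases hij : i = j
        · rw [hij, hdj, zero_mul]
        · exact mul_nonpos_of_nonneg_of_nonpos (d0 i)
            (by exact_mod_cast A.off_diag i j hij)).1 (hm.symm.trans hm1) k
        (Finset.mem_univ k)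
      have h3 := (mul_eq_zero.1 h2).resolve_left (dΘ k hk).ne'
      exact (A.zero_iff _ _).2 (Int.cast_eq_zero.1 h3)

/-! ### The faces `R(Θ)` -/

/-- The antidominant `y = ∑ c_i h_i` exposes this face. Its value at `w m`, with `m` dominant, is
that of `w⁻¹ y` at `m`, and `w⁻¹ y` is a non-negative combination of coroots. If the value is zero,
`m` kills the coroots in the support of `w⁻¹ y`, hence also `w⁻¹ h_i` for `i ∈ Θ`. -/
theorem isFace_RSet {Θ : Set ι} (hΘ : A.IsSpecial Θ) : D.IsFace (D.RSet Θ) := by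
  obtain ⟨c, c0, cΘ, hc⟩ := A.exists_antidominant hΘ
  have key : ∀ l ∈ D.tits, 0 ≤ D.evalComb l c ∧
      (D.evalComb l c = 0 → ∀ i ∈ Θ, l (D.h i) = 0) := by
    rintro _ ⟨w, m, hm, rfl⟩
    obtain ⟨d, d0, dΘ, deval, dspan, -⟩ := D.exists_orbit c0 cΘ hc w⁻¹
    have e := deval m
    rw [inv_inv] at e
    rw [e]
    have hnn : ∀ i ∈ Finset.univ, 0 ≤ d i * m (D.h i) := fun i _ => mul_nonneg (d0 i) (hm i)
    refine ⟨Finset.sum_nonneg hnn, fun h0 i hi => ?_⟩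
    have h1 := (Finset.sum_eq_zero_iff_of_nonneg hnn).1 h0
    have h2 : ∀ x ∈ Submodule.span ℤ (D.h '' {k | 0 < d k}), m x = 0 := by
      intro x hx
      induction hx using Submodule.span_induction with
      | zero => exact map_zero m
      | add x y _ _ h1 h2 => rw [map_add, h1, h2, add_zero]
      | smul a x _ h1 => rw [map_smul, h1, smul_zero]
      | mem x hx =>
        obtain ⟨k, hk, rfl⟩ := hx
        exact (mul_eq_zero.1 (h1 k (Finset.mem_univ k))).resolve_left (ne_of_gt hk)
    exact h2 _ (dspan i hi)
  have hzero : ∀ l ∈ D.RSet Θ, D.evalComb l c = 0 := by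
    intro l hl
    refine Finset.sum_eq_zero fun i _ => ?_
    by_cases hi : i ∈ Θ
    · rw [hl.2 i hi, mul_zero]
    · rw [le_antisymm (not_lt.1 fun h => hi ((cΘ i).1 h)) (c0 i), zero_mul]
  have hlin : ∀ (a b : ℝ) (x y : H →ₗ[ℤ] ℝ),
      D.evalComb (a • x + b • y) c = a * D.evalComb x c + b * D.evalComb y c := by
    intro a b x y
    simp only [evalComb, LinearMap.add_apply, LinearMap.smul_apply, smul_eq_mul, Finset.mul_sum,
      ← Finset.sum_add_distrib]
    exact Finset.sum_congr rfl fun i _ => by ring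
  refine ⟨⟨0, D.zero_mem_tits, fun _ _ => rfl⟩, ⟨inter_subset_left, ?_⟩, ?_⟩
  · rintro x hx y hy z hz ⟨a, b, ha, hb, -, rfl⟩
    have h1 := hzero _ hz
    rw [hlin] at h1
    have h2 := mul_nonneg ha.le (key x hx).1
    have h3 := mul_nonneg hb.le (key y hy).1
    have h4 : a * D.evalComb x c = 0 := by linarith
    exact ⟨hx, (key x hx).2 ((mul_eq_zero.1 h4).resolve_left ha.ne')⟩
  · rintro x hx y hy _ ⟨⟨a, b, -, -, -, rfl⟩, hz⟩
    refine ⟨hz, fun i hi => ?_⟩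
    rw [LinearMap.add_apply, LinearMap.smul_apply, LinearMap.smul_apply, hx.2 i hi, hy.2 i hi]
    simp

theorem R_val {Θ : Set ι} (hΘ : A.IsSpecial Θ) : (D.R Θ).1 = D.RSet Θ := by
  rw [R, dif_pos (D.isFace_RSet hΘ)]

/-- Let `y` be antidominant with support `Θ`, and evaluate `w y` at a dominant point killing exactly
the `h_i` with `i ∈ Θ'`. The inclusion makes the value zero, so the support of `w y` lies in `Θ'`;
`exists_orbit` gives the rest. -/
theorem subset_of_RSet_subset {Θ Θ' : Set ι} (hΘ : A.IsSpecial Θ) {w : A.Weyl}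
    (h : D.RSet Θ' ⊆ D.act w '' D.RSet Θ) :
    Θ ⊆ Θ' ∧ (Θ' ⊆ Θ → w ∈ A.parabolic (Θ ∪ A.perp Θ)) := by
  obtain ⟨c, c0, cΘ, hc⟩ := A.exists_antidominant hΘ
  obtain ⟨d, d0, dΘ, deval, -, dpar⟩ := D.exists_orbit c0 cΘ hc w
  obtain ⟨l, hl, hlΘ⟩ := D.exists_generic Θ'
  obtain ⟨m, hm, hml⟩ := h ⟨D.chamber_subset_tits hl, fun i hi => (hlΘ i).2 hi⟩
  have h0 : D.evalComb l d = 0 := by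
    rw [← deval, ← hml, act_inv_act]
    refine Finset.sum_eq_zero fun i _ => ?_
    by_cases hi : i ∈ Θ
    · rw [hm.2 i hi, mul_zero]
    · rw [le_antisymm (not_lt.1 fun h => hi ((cΘ i).1 h)) (c0 i), zero_mul]
  have h1 := (Finset.sum_eq_zero_iff_of_nonneg fun i _ => mul_nonneg (d0 i) (hl i)).1 h0
  have h2 : ∀ k, 0 < d k → k ∈ Θ' := fun k hk =>
    (hlΘ k).1 ((mul_eq_zero.1 (h1 k (Finset.mem_univ k))).resolve_left hk.ne')
  exact ⟨fun i hi => h2 i (dΘ i hi), fun hsub => dpar fun k hk => hsub (h2 k hk)⟩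

theorem eq_of_image_RSet_eq {Θ Θ' : Set ι} (hΘ : A.IsSpecial Θ) (hΘ' : A.IsSpecial Θ')
    {w : A.Weyl} (h : D.act w '' D.RSet Θ = D.RSet Θ') :
    Θ = Θ' ∧ w ∈ A.parabolic (Θ ∪ A.perp Θ) := by
  have h1 := D.subset_of_RSet_subset hΘ h.ge
  have h' : D.RSet Θ ⊆ D.act w⁻¹ '' D.RSet Θ' := by
    intro l hl
    exact ⟨D.act w l, h ▸ mem_image_of_mem _ hl, D.act_inv_act w l⟩
  have h2 := (D.subset_of_RSet_subset hΘ' h').1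
  exact ⟨h1.1.antisymm h2, h1.2 h2⟩

end Realization

namespace Realization

variable {ι : Type*} [Fintype ι] [DecidableEq ι] {A : SymmGCM ι}
  {H : Type*} [AddCommGroup H] [Module.Free ℤ H] [Module.Finite ℤ H] (D : Realization A H)

/-! ### The parabolic subgroups `W_Θ` and `W_{Θ^⊥}` -/

theorem _root_.SymmGCM.disjoint_perp (A : SymmGCM ι) (Θ : Set ι) : Disjoint Θ (A.perp Θ) := by
  rw [Set.disjoint_left]
  intro i hi hp
  have := hp i hi
  rw [A.diag] at this
  norm_num at this

theorem act_root_of_mem_parabolic {J : Set ι} {j : ι} (hj : ∀ k ∈ J, A.a k j = 0) {v : A.Weyl}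
    (hv : v ∈ A.parabolic J) : D.act v (D.α j) = D.α j := by
  induction hv using SymmGCM.parabolic_induction with
  | one => exact D.act_one _
  | mul v hv k hk ih => rw [act_mul, act_simple_root, hj k hk, zero_smul, sub_zero, ih]

theorem act_perp_root {Θ : Set ι} {j : ι} (hj : j ∈ Θ) {a : A.Weyl}
    (ha : a ∈ A.parabolic (A.perp Θ)) : D.act a (D.α j) = D.α j :=
  D.act_root_of_mem_parabolic (fun k (hk : k ∈ A.perp Θ) => hk j hj) ha

theorem act_root_perp {Θ : Set ι} {j : ι} (hj : j ∈ A.perp Θ) {b : A.Weyl}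
    (hb : b ∈ A.parabolic Θ) : D.act b (D.α j) = D.α j :=
  D.act_root_of_mem_parabolic (fun k hk => (A.zero_iff k j).2 (hj k hk)) hb

include D in
-- For `j ∈ Θ^⊥` the group `W_Θ` fixes `α_j`, hence commutes with `σ_j`.
theorem exists_perp_mul {Θ : Set ι} {v : A.Weyl} (hv : v ∈ A.parabolic (Θ ∪ A.perp Θ)) :
    ∃ a ∈ A.parabolic (A.perp Θ), ∃ b ∈ A.parabolic Θ, v = a * b := by
  induction hv using SymmGCM.parabolic_induction with
  | one => exact ⟨1, one_mem _, 1, one_mem _, (mul_one 1).symm⟩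
  | mul v hv j hj ih =>
    obtain ⟨a, ha, b, hb, rfl⟩ := ih
    rcases hj with hj | hj
    · exact ⟨a, ha, b * A.σ j, mul_mem hb (A.simple_mem_parabolic hj), mul_assoc _ _ _⟩
    · refine ⟨a * A.σ j, mul_mem ha (A.simple_mem_parabolic hj), b, hb, ?_⟩
      rw [mul_assoc, mul_assoc, D.simple_mul_eq_mul_simple (D.act_root_perp hj hb)]

include D in
-- Lengths add over `u`, so a descent of `u a` in `Θ` would be one of `a`; but `a ∈ W_{Θ^⊥}` has
-- none there.
theorem mul_mem_minRight {Θ : Set ι} {u a : A.Weyl} (hu : u ∈ A.minRight (Θ ∪ A.perp Θ))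
    (ha : a ∈ A.parabolic (A.perp Θ)) : u * a ∈ A.minRight Θ := by
  have haJ := A.parabolic_mono (subset_union_right (s := Θ)) ha
  rw [D.mem_minRight_iff]
  intro j hj
  rw [A.cs.not_isRightDescent_iff]
  have h1 := A.cs.not_isRightDescent_iff.1 (D.not_isRightDescent_of_notMem ha
    (Set.disjoint_left.1 (A.disjoint_perp Θ) hj))
  have h2 := D.length_mul_of_mem_minRight hu haJ
  have h3 := D.length_mul_of_mem_minRight hu
    (mul_mem haJ (A.simple_mem_parabolic (Or.inl hj : j ∈ Θ ∪ A.perp Θ)))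
  rw [mul_assoc, h2]
  change A.cs.length (u * (a * A.cs.simple j)) = _ + A.cs.length (a * A.cs.simple j) at h3
  omega

include D in
theorem mul_mem_minLeft {Θ : Set ι} {a w : A.Weyl} (hw : w ∈ A.minLeft (Θ ∪ A.perp Θ))
    (ha : a ∈ A.parabolic (A.perp Θ)) : a * w ∈ A.minLeft Θ := by
  rw [← inv_mem_minRight_iff, mul_inv_rev]
  exact D.mul_mem_minRight (inv_mem_minRight_iff.2 hw) (inv_mem ha)

include D in
theorem exists_minRight_mul_perp {Θ : Set ι} {w : A.Weyl} (hw : w ∈ A.minRight Θ) :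
    ∃ u ∈ A.minRight (Θ ∪ A.perp Θ), ∃ a ∈ A.parabolic (A.perp Θ), w = u * a := by
  obtain ⟨u, hu, v, hv, rfl⟩ := exists_minRight_mul (Θ ∪ A.perp Θ) w
  obtain ⟨a, ha, b, hb, rfl⟩ := D.exists_perp_mul hv
  refine ⟨u, hu, a, ha, (D.eq_of_mem_minRight (D.mul_mem_minRight hu ha) hw ?_).symm⟩
  have e : (u * a)⁻¹ * (u * (a * b)) = b := by group
  rwa [e]

include D in
theorem exists_perp_mul_minLeft {Θ : Set ι} {w : A.Weyl} (hw : w ∈ A.minLeft Θ) :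
    ∃ a ∈ A.parabolic (A.perp Θ), ∃ u ∈ A.minLeft (Θ ∪ A.perp Θ), w = a * u := by
  obtain ⟨u, hu, a, ha, h⟩ := D.exists_minRight_mul_perp (inv_mem_minRight_iff.2 hw)
  refine ⟨a⁻¹, inv_mem ha, u⁻¹, inv_mem_minRight_iff.1 (by rwa [inv_inv]), ?_⟩
  rw [← mul_inv_rev, ← h, inv_inv]

/-! ### Equality in the Weyl monoid -/

theorem cls_eq_iff (F G : D.Face) (v w : A.Weyl) :
    D.cls F v = D.cls G w ↔ F = G ∧ w * v⁻¹ ∈ D.pointStab F.1 := D.faceCon.eq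

theorem ofWeyl_mul_e_mul_ofWeyl (F : D.Face) (v w : A.Weyl) :
    D.ofWeyl v * D.e F * D.ofWeyl w = D.cls ⟨D.act v '' F.1, F.2.image v⟩ (v * w) := by
  have h : ((⟨⟨D.tits, D.isFace_tits⟩, v⟩ : D.FaceWeyl) * ⟨F, 1⟩) * ⟨⟨D.tits, D.isFace_tits⟩, w⟩ =
      ⟨⟨D.act v '' F.1, F.2.image v⟩, v * w⟩ := by
    refine FaceWeyl.ext (Subtype.ext ?_) ?_
    · change (D.tits ∩ D.act v '' F.1) ∩ D.act (v * 1) '' D.tits = D.act v '' F.1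
      rw [inter_eq_right.2 (F.2.image v).extreme.subset]
      refine inter_eq_left.2 ?_
      rw [mul_one]
      exact image_mono F.2.extreme.subset
    · change v * 1 * w = v * w
      rw [mul_one]
  change D.faceCon.mk' _ * D.faceCon.mk' _ * D.faceCon.mk' _ = _
  rw [← map_mul, ← map_mul, h]
  rfl

theorem ofWeyl_mul_ofWeyl (v w : A.Weyl) : D.ofWeyl v * D.ofWeyl w = D.ofWeyl (v * w) := by
  have h : (⟨⟨D.tits, D.isFace_tits⟩, v⟩ : D.FaceWeyl) * ⟨⟨D.tits, D.isFace_tits⟩, w⟩ =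
      ⟨⟨D.tits, D.isFace_tits⟩, v * w⟩ := by
    refine FaceWeyl.ext (Subtype.ext ?_) rfl
    change D.tits ∩ D.act v '' D.tits = D.tits
    exact inter_eq_left.2 fun l hl => ⟨_, D.act_mem_tits v⁻¹ hl, D.act_act_inv v l⟩
  change D.faceCon.mk' _ * D.faceCon.mk' _ = _
  rw [← map_mul, h]
  rfl

theorem conj_mem_pointStab_image_iff (F : Set (H →ₗ[ℤ] ℝ)) (v w : A.Weyl) :
    w ∈ D.pointStab (D.act v '' F) ↔ v⁻¹ * w * v ∈ D.pointStab F := by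
  constructor
  · intro h l hl
    rw [act_mul, act_mul, h _ (mem_image_of_mem _ hl), act_inv_act]
  · rintro h _ ⟨l, hl, rfl⟩
    have h1 := congrArg (D.act v) (h l hl)
    rwa [act_mul, act_mul, act_act_inv] at h1

/-- `v e(R(Θ)) w` is the class of `(v R(Θ), v w)`. Equality of the faces is decided by the setwise
stabilizer `W_{Θ ∪ Θ^⊥}`, and then equality of the classes by the pointwise stabilizer `W_Θ`,
conjugated by `v`. -/
theorem form_eq_iff {Θ Θ' : Set ι} (hΘ : A.IsSpecial Θ) (hΘ' : A.IsSpecial Θ')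
    (v w v' w' : A.Weyl) :
    D.ofWeyl v * D.e (D.R Θ) * D.ofWeyl w = D.ofWeyl v' * D.e (D.R Θ') * D.ofWeyl w' ↔
      Θ = Θ' ∧ v'⁻¹ * v ∈ A.parabolic (Θ ∪ A.perp Θ) ∧ v⁻¹ * v' * (w' * w⁻¹) ∈ A.parabolic Θ := by
  have hstab : (v' * w') * (v * w)⁻¹ ∈ D.pointStab (D.act v '' D.RSet Θ) ↔
      v⁻¹ * v' * (w' * w⁻¹) ∈ A.parabolic Θ := by
    rw [conj_mem_pointStab_image_iff, pointStab_RSet, SetLike.mem_coe]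
    have e : v⁻¹ * (v' * w' * (v * w)⁻¹) * v = v⁻¹ * v' * (w' * w⁻¹) := by group
    rw [e]
  rw [ofWeyl_mul_e_mul_ofWeyl, ofWeyl_mul_e_mul_ofWeyl, cls_eq_iff, Subtype.mk.injEq]
  change D.act v '' (D.R Θ).1 = D.act v' '' (D.R Θ').1 ∧
    v' * w' * (v * w)⁻¹ ∈ D.pointStab (D.act v '' (D.R Θ).1) ↔ _
  rw [D.R_val hΘ, D.R_val hΘ', hstab]
  constructor
  · rintro ⟨h1, h2⟩
    have h3 : D.act (v'⁻¹ * v) '' D.RSet Θ = D.RSet Θ' := by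
      have h4 := congrArg (D.act v'⁻¹ '' ·) h1
      simp only [image_image, act_inv_act, image_id'] at h4
      simpa only [act_mul] using h4
    obtain ⟨h4, h5⟩ := D.eq_of_image_RSet_eq hΘ hΘ' h3
    exact ⟨h4, h5, h2⟩
  · rintro ⟨rfl, h1, h2⟩
    refine ⟨?_, h2⟩
    obtain ⟨a, ha, b, hb, h⟩ := D.exists_perp_mul h1
    have hv : v = v' * (a * b) := by rw [← h, mul_inv_cancel_left]
    have hb' : D.act b '' D.RSet Θ = D.RSet Θ := by
      conv_rhs => rw [← image_id' (D.RSet Θ)]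
      exact image_congr fun l hl => D.act_eq_of_mem_parabolic hb hl.2
    have hfun : ∀ l : H →ₗ[ℤ] ℝ, D.act v l = D.act v' (D.act a (D.act b l)) := by
      intro l
      rw [hv, act_mul, act_mul]
    calc D.act v '' D.RSet Θ = D.act v' '' (D.act a '' (D.act b '' D.RSet Θ)) := by
          simp only [image_image, hfun]
      _ = D.act v' '' D.RSet Θ := by rw [hb', D.act_perp_image_RSet ha]

/-! ### A common refinement of the two normal forms -/

/-- `x = u a e(R(Θ)) w` with `Θ` special, `u ∈ W^{Θ ∪ Θ^⊥}`, `a ∈ W_{Θ^⊥}` and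
`w ∈ ^{Θ ∪ Θ^⊥}W`. -/
structure IsCentralForm (x : D.WeylMonoid) (u a : A.Weyl) (Θ : Set ι) (w : A.Weyl) : Prop where
  special : A.IsSpecial Θ
  left : u ∈ A.minRight (Θ ∪ A.perp Θ)
  middle : a ∈ A.parabolic (A.perp Θ)
  right : w ∈ A.minLeft (Θ ∪ A.perp Θ)
  eq : x = D.ofWeyl (u * a) * D.e (D.R Θ) * D.ofWeyl w

namespace IsCentralForm

variable {D} {x : D.WeylMonoid} {u a w : A.Weyl} {Θ : Set ι}

theorem middle_mem (h : D.IsCentralForm x u a Θ w) : a ∈ A.parabolic (Θ ∪ A.perp Θ) :=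
  A.parabolic_mono subset_union_right h.middle

theorem length_left (h : D.IsCentralForm x u a Θ w) :
    A.cs.length (u * a) = A.cs.length u + A.cs.length a :=
  D.length_mul_of_mem_minRight h.left h.middle_mem

theorem length_right (h : D.IsCentralForm x u a Θ w) :
    A.cs.length (a * w) = A.cs.length a + A.cs.length w :=
  D.length_mul_of_mem_minLeft h.right h.middle_mem

theorem isNormalFormI (h : D.IsCentralForm x u a Θ w) : D.IsNormalFormI x (u * a) Θ w :=
  ⟨h.special, D.mul_mem_minRight h.left h.middle, h.right, h.eq⟩

theorem eq' (h : D.IsCentralForm x u a Θ w) :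
    x = D.ofWeyl u * D.e (D.R Θ) * D.ofWeyl (a * w) := by
  rw [h.eq, D.form_eq_iff h.special h.special]
  refine ⟨rfl, ?_, ?_⟩
  · rw [inv_mul_cancel_left]
    exact h.middle_mem
  · have e : (u * a)⁻¹ * u * (a * w * w⁻¹) = 1 := by group
    rw [e]
    exact one_mem _

theorem isNormalFormII (h : D.IsCentralForm x u a Θ w) : D.IsNormalFormII x u Θ (a * w) :=
  ⟨h.special, h.left, D.mul_mem_minLeft h.right h.middle, h.eq'⟩

theorem unique (h : D.IsCentralForm x u a Θ w) {u' a' w' : A.Weyl} {Θ' : Set ι}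
    (h' : D.IsCentralForm x u' a' Θ' w') : u = u' ∧ a = a' ∧ Θ = Θ' ∧ w = w' := by
  obtain ⟨hΘ, h1, h2⟩ := (D.form_eq_iff h.special h'.special _ _ _ _).1 (h.eq.symm.trans h'.eq)
  subst hΘ
  have hu : u = u' := by
    refine (D.eq_of_mem_minRight h'.left h.left ?_).symm
    have e : u'⁻¹ * u = a' * ((u' * a')⁻¹ * (u * a)) * a⁻¹ := by group
    rw [e]
    exact mul_mem (mul_mem h'.middle_mem h1) (inv_mem h.middle_mem)
  subst hu
  have hw : w = w' := by
    refine (D.eq_of_mem_minLeft h'.right h.right ?_).symm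
    have e : w' * w⁻¹ = (a'⁻¹ * a) * ((u * a)⁻¹ * (u * a') * (w' * w⁻¹)) := by group
    rw [e]
    exact mul_mem (mul_mem (inv_mem h'.middle_mem) h.middle_mem)
      (A.parabolic_mono subset_union_left h2)
  subst hw
  have e : (u * a)⁻¹ * (u * a') * (w * w⁻¹) = a⁻¹ * a' := by group
  rw [e] at h2
  -- The criterion determines `a` only modulo `W_Θ`, which meets `W_{Θ^⊥}` trivially.
  have ha := D.parabolic_disjoint (A.disjoint_perp Θ) h2 (mul_mem (inv_mem h.middle) h'.middle)
  exact ⟨rfl, inv_mul_eq_one.1 ha, rfl, rfl⟩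

end IsCentralForm

variable {D} in
theorem IsNormalFormI.exists_isCentralForm {x : D.WeylMonoid} {w₁ w₂ : A.Weyl} {Θ : Set ι}
    (h : D.IsNormalFormI x w₁ Θ w₂) : ∃ u a, w₁ = u * a ∧ D.IsCentralForm x u a Θ w₂ := by
  obtain ⟨u, hu, a, ha, rfl⟩ := D.exists_minRight_mul_perp h.left
  exact ⟨u, a, rfl, h.special, hu, ha, h.right, h.eq⟩

variable {D} in
theorem IsNormalFormII.exists_isCentralForm {x : D.WeylMonoid} {w₁ w₂ : A.Weyl} {Θ : Set ι}
    (h : D.IsNormalFormII x w₁ Θ w₂) : ∃ a w, w₂ = a * w ∧ D.IsCentralForm x w₁ a Θ w := by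
  obtain ⟨a, ha, w, hw, rfl⟩ := D.exists_perp_mul_minLeft h.right
  refine ⟨a, w, rfl, h.special, h.left, ha, hw, ?_⟩
  rw [h.eq, D.form_eq_iff h.special h.special]
  refine ⟨rfl, ?_, ?_⟩
  · have e : (w₁ * a)⁻¹ * w₁ = a⁻¹ := by group
    rw [e]
    exact inv_mem (A.parabolic_mono subset_union_right ha)
  · have e : w₁⁻¹ * (w₁ * a) * (w * (a * w)⁻¹) = 1 := by group
    rw [e]
    exact one_mem _

namespace IsCentralForm

variable {D} {x : D.WeylMonoid} {u a w : A.Weyl} {Θ : Set ι}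

/-- The length is read off a chosen normal form, but any choice refines to the unique central form.
-/
theorem lpp_eq (h : D.IsCentralForm x u a Θ w) :
    D.lpp x = A.cs.length u + A.cs.length a - A.cs.length w := by
  have hx : ∃ t : A.Weyl × Set ι × A.Weyl, D.IsNormalFormI x t.1 t.2.1 t.2.2 :=
    ⟨(u * a, Θ, w), h.isNormalFormI⟩
  rw [lpp, dif_pos hx]
  obtain ⟨u', a', e, h'⟩ := hx.choose_spec.exists_isCentralForm
  obtain ⟨h1, h2, -, h4⟩ := h.unique h'
  rw [e, ← h1, ← h2, ← h4, h.length_left]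
  push_cast
  rfl

theorem lmm_eq (h : D.IsCentralForm x u a Θ w) :
    D.lmm x = -A.cs.length u + A.cs.length a + A.cs.length w := by
  have hx : ∃ t : A.Weyl × Set ι × A.Weyl, D.IsNormalFormII x t.1 t.2.1 t.2.2 :=
    ⟨(u, Θ, a * w), h.isNormalFormII⟩
  rw [lmm, dif_pos hx]
  obtain ⟨a', w', e, h'⟩ := hx.choose_spec.exists_isCentralForm
  obtain ⟨h1, h2, -, h4⟩ := h.unique h'
  rw [e, ← h1, ← h2, ← h4, h.length_right]
  push_cast
  ring

theorem lmp_eq (h : D.IsCentralForm x u a Θ w) :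
    D.lmp x = A.cs.length u + A.cs.length a + A.cs.length w := by
  have hx : ∃ t : A.Weyl × Set ι × A.Weyl,
      D.IsNormalFormI x t.1 t.2.1 t.2.2 ∨ D.IsNormalFormII x t.1 t.2.1 t.2.2 :=
    ⟨(u * a, Θ, w), Or.inl h.isNormalFormI⟩
  rw [lmp, dif_pos hx]
  rcases hx.choose_spec with hI | hII
  · obtain ⟨u', a', e, h'⟩ := hI.exists_isCentralForm
    obtain ⟨h1, h2, -, h4⟩ := h.unique h'
    rw [e, ← h1, ← h2, ← h4, h.length_left]
  · obtain ⟨a', w', e, h'⟩ := hII.exists_isCentralForm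
    obtain ⟨h1, h2, -, h4⟩ := h.unique h'
    rw [e, ← h1, ← h2, ← h4, h.length_right, add_assoc]

end IsCentralForm

/-! ### Change of the lengths under multiplication by a simple reflection -/

/-- The possible changes of three functions `f`, `g`, `k` under the passage from `x` to `y`, in
terms of the position of the root `β`: unless `y = x`, the functions `f` and `k` increase by the
sign `s` of `β`, and `g` decreases or increases by `s`. -/
def StepRule {M : Type*} (f g k : M → ℤ) (x y : M) (β : Module.Dual ℤ H) (Θ : Set ι) : Prop :=
  (y = x ∧ β ∈ D.subRoots Θ ∧ β ∉ D.subRoots (A.perp Θ)) ∨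
  ∃ s : ℤ, (s = 1 ∧ β ∈ D.posRoots ∧ β ∉ D.negRoots ∨ s = -1 ∧ β ∈ D.negRoots ∧ β ∉ D.posRoots) ∧
    f y = f x + s ∧ k y = k x + s ∧
    (g y = g x - s ∧ β ∉ D.subRoots (Θ ∪ A.perp Θ) ∨
      g y = g x + s ∧ β ∈ D.subRoots (A.perp Θ) ∧ β ∉ D.subRoots Θ)

namespace LengthRule

variable {M P : Type*} {f : M → ℤ} {x y : M} {β : P} {S T U : Set P}

theorem of_mem_plus (hS : β ∈ S) (hT : β ∉ T) (hU : β ∉ U) (h : f y = f x + 1) :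
    LengthRule f x y β S T U :=
  ⟨Or.inl hS, fun _ => h, fun h' => (hT h').elim, fun h' => (hU h').elim,
    fun h' => by omega, fun h' => by rw [h']⟩

theorem of_mem_minus (hS : β ∉ S) (hT : β ∉ T) (hU : β ∈ U) (h : f y = f x - 1) :
    LengthRule f x y β S T U :=
  ⟨Or.inr (Or.inr hU), fun h' => (hS h').elim, fun h' => (hT h').elim, fun _ => h,
    fun h' => by omega, fun h' => by rw [h']⟩

theorem of_mem_zero (hS : β ∉ S) (hT : β ∈ T) (hU : β ∉ U) (h : y = x) :
    LengthRule f x y β S T U :=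
  ⟨Or.inr (Or.inl hT), fun h' => (hS h').elim, fun _ => by rw [h], fun h' => (hU h').elim,
    fun _ => h, fun _ => by rw [h]⟩

end LengthRule

variable {D} in
-- The sign and the parabolic position of `β` single out one listed case for each function. A change
-- by `±1` settles the equivalence with `y = x`.
theorem StepRule.lengthRules {M : Type*} {f g k : M → ℤ} {x y : M} {β : Module.Dual ℤ H}
    {Θ : Set ι} (h : D.StepRule f g k x y β Θ) :
    LengthRule f x y β (D.posRoots \ D.subRoots Θ) (D.subRoots Θ) (D.negRoots \ D.subRoots Θ) ∧
    LengthRule g x y β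
      ((D.negRoots \ D.subRoots (Θ ∪ A.perp Θ)) ∪ (D.posRoots ∩ D.subRoots (A.perp Θ)))
      (D.subRoots Θ)
      ((D.posRoots \ D.subRoots (Θ ∪ A.perp Θ)) ∪ (D.negRoots ∩ D.subRoots (A.perp Θ))) ∧
    LengthRule k x y β (D.posRoots \ D.subRoots Θ) (D.subRoots Θ) (D.negRoots \ D.subRoots Θ) := by
  have hΘ : β ∈ D.subRoots Θ → β ∈ D.subRoots (Θ ∪ A.perp Θ) :=
    fun h => D.subRoots_mono subset_union_left h
  have hp : β ∈ D.subRoots (A.perp Θ) → β ∈ D.subRoots (Θ ∪ A.perp Θ) :=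
    fun h => D.subRoots_mono subset_union_right h
  rcases h with ⟨rfl, h1, h2⟩ | ⟨s, ⟨rfl, hs, hs'⟩ | ⟨rfl, hs, hs'⟩, hf, hk, ⟨hg, hb⟩ | ⟨hg, hb, hb'⟩⟩
  · refine ⟨.of_mem_zero ?_ ?_ ?_ rfl, .of_mem_zero ?_ ?_ ?_ rfl, .of_mem_zero ?_ ?_ ?_ rfl⟩ <;>
      (try simp only [mem_union, mem_inter_iff, mem_sdiff]) <;> tauto
  · refine ⟨.of_mem_plus ?_ ?_ ?_ hf, .of_mem_minus ?_ ?_ ?_ hg, .of_mem_plus ?_ ?_ ?_ hk⟩ <;>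
      (try simp only [mem_union, mem_inter_iff, mem_sdiff]) <;> tauto
  · refine ⟨.of_mem_plus ?_ ?_ ?_ hf, .of_mem_plus ?_ ?_ ?_ hg, .of_mem_plus ?_ ?_ ?_ hk⟩ <;>
      (try simp only [mem_union, mem_inter_iff, mem_sdiff]) <;> tauto
  · refine ⟨.of_mem_minus ?_ ?_ ?_ hf, .of_mem_plus ?_ ?_ ?_ (by linarith),
      .of_mem_minus ?_ ?_ ?_ hk⟩ <;>
      (try simp only [mem_union, mem_inter_iff, mem_sdiff]) <;> tauto
  · refine ⟨.of_mem_minus ?_ ?_ ?_ hf, .of_mem_minus ?_ ?_ ?_ hg, .of_mem_minus ?_ ?_ ?_ hk⟩ <;>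
      (try simp only [mem_union, mem_inter_iff, mem_sdiff]) <;> tauto

theorem exists_sign (w : A.Weyl) (i : ι) : ∃ s : ℤ,
    (s = 1 ∧ D.act w (D.α i) ∈ D.posRoots ∧ D.act w (D.α i) ∉ D.negRoots ∨
      s = -1 ∧ D.act w (D.α i) ∈ D.negRoots ∧ D.act w (D.α i) ∉ D.posRoots) ∧
    (A.cs.length (w * A.σ i) : ℤ) = A.cs.length w + s := by
  simp only [mem_posRoots_iff, mem_negRoots_iff]
  have hlen : A.cs.length (w * A.σ i) = A.cs.length w + 1 ∨
      A.cs.length (w * A.σ i) + 1 = A.cs.length w := A.cs.length_mul_simple w i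
  rcases hlen with h | h
  · exact ⟨1, Or.inl ⟨rfl, h, fun h' => by omega⟩, by rw [h]; push_cast; rfl⟩
  · refine ⟨-1, Or.inr ⟨rfl, h, fun h' => by omega⟩, ?_⟩
    omega

theorem exists_sign_inv (w : A.Weyl) (i : ι) : ∃ s : ℤ,
    (s = 1 ∧ D.act w⁻¹ (D.α i) ∈ D.posRoots ∧ D.act w⁻¹ (D.α i) ∉ D.negRoots ∨
      s = -1 ∧ D.act w⁻¹ (D.α i) ∈ D.negRoots ∧ D.act w⁻¹ (D.α i) ∉ D.posRoots) ∧
    (A.cs.length (A.σ i * w) : ℤ) = A.cs.length w + s := by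
  obtain ⟨s, hs, h⟩ := D.exists_sign w⁻¹ i
  refine ⟨s, hs, ?_⟩
  rwa [← A.cs.length_inv (w⁻¹ * A.σ i), mul_inv_rev, inv_inv, CoxeterSystem.inv_simple,
    CoxeterSystem.length_inv] at h

variable {D} in
theorem IsCentralForm.stepRule_left {x : D.WeylMonoid} {u a w : A.Weyl} {Θ : Set ι}
    (h : D.IsCentralForm x u a Θ w) (i : ι) :
    D.StepRule D.lpp D.lmm (fun z => (D.lmp z : ℤ)) x (D.ofWeyl (A.σ i) * x)
      (D.act (u * a)⁻¹ (D.α i)) Θ := by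
  have hx : D.ofWeyl (A.σ i) * x = D.ofWeyl (A.σ i * (u * a)) * D.e (D.R Θ) * D.ofWeyl w := by
    rw [h.eq, ← mul_assoc, ← mul_assoc, ofWeyl_mul_ofWeyl]
  rcases D.simple_mul_mem_minRight_or h.left i with hi | ⟨j, hj, hju, hcomm⟩
  -- Only `u` changes. The sign of `β` governs `l(u a)`, and `l(a)` is constant, so `l(u)` changes
  -- by that sign.
  · have h' : D.IsCentralForm (D.ofWeyl (A.σ i) * x) (A.σ i * u) a Θ w :=
      ⟨h.special, hi, h.middle, h.right, by rw [hx, ← mul_assoc (A.σ i)]⟩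
    obtain ⟨s, hs, hl⟩ := D.exists_sign_inv (u * a) i
    rw [← mul_assoc, h'.length_left, h.length_left] at hl
    push_cast at hl
    refine Or.inr ⟨s, hs, ?_, ?_, Or.inl ⟨?_, ?_⟩⟩
    · rw [h'.lpp_eq, h.lpp_eq]
      linarith
    · simp only [h'.lmp_eq, h.lmp_eq]
      push_cast
      linarith
    · rw [h'.lmm_eq, h.lmm_eq]
      linarith
    · rw [mul_inv_rev, act_mul]
      exact D.notMem_subRoots h.left hi (inv_mem h.middle_mem)
  · have huj : D.act u⁻¹ (D.α i) = D.α j := by rw [← hju, act_inv_act]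
    rw [mul_inv_rev, act_mul, huj]
    rcases hj with hj | hj
    -- For `j ∈ Θ`, `σ_i u a = u a σ_j`, and `σ_j` fixes `R(Θ)` pointwise.
    · refine Or.inl ⟨?_, ?_⟩
      · rw [hx, h.eq, D.form_eq_iff h.special h.special]
        have hσ := D.simple_mul_eq_mul_simple (D.act_perp_root hj h.middle)
        have e : A.σ i * (u * a) = u * a * A.σ j := by
          rw [← mul_assoc, hcomm, mul_assoc, hσ, mul_assoc]
        rw [e]
        refine ⟨rfl, ?_, ?_⟩
        · rw [inv_mul_cancel_left]
          exact A.simple_mem_parabolic (Or.inl hj)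
        · have e : (u * a * A.σ j)⁻¹ * (u * a) * (w * w⁻¹) = (A.σ j)⁻¹ := by group
          rw [e]
          exact inv_mem (A.simple_mem_parabolic hj)
      · rw [D.act_perp_root hj (inv_mem h.middle)]
        have hmem : D.α j ∈ D.subRoots Θ := by
          simpa only [act_one] using D.act_mem_subRoots (one_mem _) hj
        exact ⟨hmem, Set.disjoint_left.1 (D.disjoint_subRoots (A.disjoint_perp Θ)) hmem⟩
    -- For `j ∈ Θ^⊥` only `a` changes, and `β = a⁻¹ α_j`. As `a` enters all three lengths with sign
    -- `+`, they change alike.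
    · have h' : D.IsCentralForm (D.ofWeyl (A.σ i) * x) u (A.σ j * a) Θ w :=
        ⟨h.special, h.left, mul_mem (A.simple_mem_parabolic hj) h.middle, h.right, by
          rw [hx, ← mul_assoc (A.σ i), hcomm, mul_assoc u]⟩
      obtain ⟨s, hs, hl⟩ := D.exists_sign_inv a j
      have hmem := D.act_mem_subRoots (inv_mem h.middle) hj
      refine Or.inr ⟨s, hs, ?_, ?_, Or.inr ⟨?_, hmem,
        Set.disjoint_right.1 (D.disjoint_subRoots (A.disjoint_perp Θ)) hmem⟩⟩
      · rw [h'.lpp_eq, h.lpp_eq]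
        linarith
      · simp only [h'.lmp_eq, h.lmp_eq]
        push_cast
        linarith
      · rw [h'.lmm_eq, h.lmm_eq]
        linarith

variable {D} in
-- The alternative is now applied to `w⁻¹`. Since `u` and `w` enter `l₊₊` and `l₋₋` with opposite
-- signs, these functions trade places.
theorem IsCentralForm.stepRule_right {x : D.WeylMonoid} {u a w : A.Weyl} {Θ : Set ι}
    (h : D.IsCentralForm x u a Θ w) (i : ι) :
    D.StepRule D.lmm D.lpp (fun z => (D.lmp z : ℤ)) x (x * D.ofWeyl (A.σ i))
      (D.act (a * w) (D.α i)) Θ := by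
  have hx : x * D.ofWeyl (A.σ i) = D.ofWeyl (u * a) * D.e (D.R Θ) * D.ofWeyl (w * A.σ i) := by
    rw [h.eq, mul_assoc, ofWeyl_mul_ofWeyl]
  have hw := inv_mem_minRight_iff.2 h.right
  rcases D.simple_mul_mem_minRight_or hw i with hi | ⟨j, hj, hju, hcomm⟩
  · have hi' : w * A.σ i ∈ A.minLeft (Θ ∪ A.perp Θ) := by
      rwa [← inv_mem_minRight_iff, mul_inv_rev, CoxeterSystem.inv_simple]
    have h' : D.IsCentralForm (x * D.ofWeyl (A.σ i)) u a Θ (w * A.σ i) :=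
      ⟨h.special, h.left, h.middle, hi', hx⟩
    obtain ⟨s, hs, hl⟩ := D.exists_sign (a * w) i
    rw [mul_assoc, h'.length_right, h.length_right] at hl
    push_cast at hl
    refine Or.inr ⟨s, hs, ?_, ?_, Or.inl ⟨?_, ?_⟩⟩
    · rw [h'.lmm_eq, h.lmm_eq]
      linarith
    · simp only [h'.lmp_eq, h.lmp_eq]
      push_cast
      linarith
    · rw [h'.lpp_eq, h.lpp_eq]
      linarith
    · have := D.notMem_subRoots hw hi h.middle_mem
      rwa [inv_inv, ← act_mul] at this
  · have huj : D.act w (D.α i) = D.α j := by rw [← hju, act_act_inv]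
    have hcomm' : w * A.σ i = A.σ j * w := by
      have := congrArg (·⁻¹) hcomm
      simpa only [mul_inv_rev, inv_inv, CoxeterSystem.inv_simple] using this
    rw [act_mul, huj]
    rcases hj with hj | hj
    · refine Or.inl ⟨?_, ?_⟩
      · rw [hx, h.eq, D.form_eq_iff h.special h.special, hcomm']
        refine ⟨rfl, ?_, ?_⟩
        · rw [inv_mul_cancel]
          exact one_mem _
        · have e : (u * a)⁻¹ * (u * a) * (w * (A.σ j * w)⁻¹) = (A.σ j)⁻¹ := by group
          rw [e]
          exact inv_mem (A.simple_mem_parabolic hj)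
      · rw [D.act_perp_root hj h.middle]
        have hmem : D.α j ∈ D.subRoots Θ := by
          simpa only [act_one] using D.act_mem_subRoots (one_mem _) hj
        exact ⟨hmem, Set.disjoint_left.1 (D.disjoint_subRoots (A.disjoint_perp Θ)) hmem⟩
    · have hjp := A.simple_mem_parabolic hj
      have h' : D.IsCentralForm (x * D.ofWeyl (A.σ i)) u (a * A.σ j) Θ w := by
        refine ⟨h.special, h.left, mul_mem h.middle hjp, h.right, ?_⟩
        rw [hx, hcomm', D.form_eq_iff h.special h.special]
        refine ⟨rfl, ?_, ?_⟩
        · have e : (u * (a * A.σ j))⁻¹ * (u * a) = (A.σ j)⁻¹ := by group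
          rw [e]
          exact inv_mem (A.simple_mem_parabolic (Or.inr hj))
        · have e : (u * a)⁻¹ * (u * (a * A.σ j)) * (w * (A.σ j * w)⁻¹) = 1 := by group
          rw [e]
          exact one_mem _
      obtain ⟨s, hs, hl⟩ := D.exists_sign a j
      have hmem := D.act_mem_subRoots h.middle hj
      refine Or.inr ⟨s, hs, ?_, ?_, Or.inr ⟨?_, hmem,
        Set.disjoint_right.1 (D.disjoint_subRoots (A.disjoint_perp Θ)) hmem⟩⟩
      · rw [h'.lmm_eq, h.lmm_eq]
        linarith
      · simp only [h'.lmp_eq, h.lmp_eq]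
        push_cast
        linarith
      · rw [h'.lpp_eq, h.lpp_eq]
        linarith

end Realization

theorem theorem3p3 {ι : Type*} [Fintype ι] [DecidableEq ι] (A : SymmGCM ι)
    {H : Type*} [AddCommGroup H] [Module.Free ℤ H] [Module.Finite ℤ H] (D : Realization A H)
    (x : D.WeylMonoid) (w₁ : A.Weyl) (Θ : Set ι) (w₂ : A.Weyl) (i : ι) :
    (D.IsNormalFormI x w₁ Θ w₂ →
      Realization.LengthRule D.lpp x (D.ofWeyl (A.σ i) * x) (D.act w₁⁻¹ (D.α i))
        (D.posRoots \ D.subRoots Θ)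
        (D.subRoots Θ)
        (D.negRoots \ D.subRoots Θ) ∧
      Realization.LengthRule D.lmm x (D.ofWeyl (A.σ i) * x) (D.act w₁⁻¹ (D.α i))
        ((D.negRoots \ D.subRoots (Θ ∪ A.perp Θ)) ∪ (D.posRoots ∩ D.subRoots (A.perp Θ)))
        (D.subRoots Θ)
        ((D.posRoots \ D.subRoots (Θ ∪ A.perp Θ)) ∪ (D.negRoots ∩ D.subRoots (A.perp Θ))) ∧
      Realization.LengthRule (fun z => (D.lmp z : ℤ)) x (D.ofWeyl (A.σ i) * x)
        (D.act w₁⁻¹ (D.α i))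
        (D.posRoots \ D.subRoots Θ)
        (D.subRoots Θ)
        (D.negRoots \ D.subRoots Θ)) ∧
    (D.IsNormalFormII x w₁ Θ w₂ →
      Realization.LengthRule D.lpp x (x * D.ofWeyl (A.σ i)) (D.act w₂ (D.α i))
        ((D.negRoots \ D.subRoots (Θ ∪ A.perp Θ)) ∪ (D.posRoots ∩ D.subRoots (A.perp Θ)))
        (D.subRoots Θ)
        ((D.posRoots \ D.subRoots (Θ ∪ A.perp Θ)) ∪ (D.negRoots ∩ D.subRoots (A.perp Θ))) ∧
      Realization.LengthRule D.lmm x (x * D.ofWeyl (A.σ i)) (D.act w₂ (D.α i))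
        (D.posRoots \ D.subRoots Θ)
        (D.subRoots Θ)
        (D.negRoots \ D.subRoots Θ) ∧
      Realization.LengthRule (fun z => (D.lmp z : ℤ)) x (x * D.ofWeyl (A.σ i))
        (D.act w₂ (D.α i))
        (D.posRoots \ D.subRoots Θ)
        (D.subRoots Θ)
        (D.negRoots \ D.subRoots Θ)) := by
  constructor
  · intro h
    obtain ⟨u, a, rfl, h'⟩ := h.exists_isCentralForm
    exact (h'.stepRule_left i).lengthRules
  · intro h
    obtain ⟨a, w, rfl, h'⟩ := h.exists_isCentralForm
    have hr := (h'.stepRule_right i).lengthRules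
    exact ⟨hr.2.1, hr.1, hr.2.2⟩
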